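/- **Theorem 1.** For a family $\mathcal F$ of subsets of $[n]$, the dual VC-dimension of $\mathcal F$ is the VC-dimension of the set system $\{\{A\in\mathcal F: x\in A\}: x\in[n]\}$ on the ground set $\mathcal F$, that is, the maximum size of a subset of $\mathcal F$ shattered by this system (and $0$ if no set is shattered, which happens only for $n=0$). 1. There is an absolute constant $C>0$ such that for every $n\ge 1$ and every family $\mathcal F$ of subsets of $[n]$: if $\mathcal F$ has dual VC-dimension at most $2$, then $|\mathcal F|\le Cn^3$; and if $|\mathcal F|\ge Cn^3$, then $\mathcal F$ contains three sets $X,Y,Z$ such that all eight regions of their Venn diagram, i.e. all sets $X'\cap Y'\cap Z'$ with $X'\in\{X,[n]\setminus X\}$, $Y'\in\{Y,[n]\setminus Y\}$, $Z'\in\{Z,[n]\setminus Z\}$, are non-empty. 2. These two forms are equivalent: for every $n\ge 0$, a family $\mathcal F$ of subsets of $[n]$ has dual VC-dimension at least $3$ if and only if it contains three sets whose Venn diagram has all eight regions non-empty. 3. The bound is sharp up to the constant: for every $n\ge 0$, the family of all subsets of $[n]$ of size at most $3$ has dual VC-dimension at most $2$, and there is an absolute constant $c>0$ such that for every $n\ge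 0$ this family has at least $cn^3$ members. -/

import Mathlib

/-- Transpose of the incidence matrix of a family `F` of subsets of an `n`-element ground set,
viewed as a set family again: the ground set now consists of the members of `F`, and each point `x`
contributes the set of all members of `F` that contain `x`. -/
def dualFamily {n : ℕ} (F : Finset (Finset (Fin n))) : Finset (Finset (Finset (Fin n))) :=
  Finset.univ.image fun x : Fin n => F.filter fun A => x ∈ A

/-- The dual VC-dimension of `F`: the VC-dimension of the transposed family. (A set shattered by
the transposed family is contained in one of its members, hence consists of members of `F`.) -/
def dualVCDim {n : ℕ} (F : Finset (Finset (Fin n))) : ℕ :=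
  (dualFamily F).vcDim

/-- All eight regions of the Venn diagram of `X`, `Y`, `Z` (complements being taken in the whole
ground set) are non-empty. -/
def IsThreeVenn {n : ℕ} (X Y Z : Finset (Fin n)) : Prop :=
  (X ∩ Y ∩ Z).Nonempty ∧ (Xᶜ ∩ Y ∩ Z).Nonempty ∧
  (X ∩ Yᶜ ∩ Z).Nonempty ∧ (X ∩ Y ∩ Zᶜ).Nonempty ∧
  (Xᶜ ∩ Yᶜ ∩ Z).Nonempty ∧ (Xᶜ ∩ Y ∩ Zᶜ).Nonempty ∧
  (X ∩ Yᶜ ∩ Zᶜ).Nonempty ∧ (Xᶜ ∩ Yᶜ ∩ Zᶜ).Nonempty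

/-- The family of all subsets of the ground set that have at most three elements. -/
def setsOfSizeAtMostThree (n : ℕ) : Finset (Finset (Fin n)) :=
  Finset.univ.filter fun A => A.card ≤ 3

/-! Complementing a member only permutes Venn regions, so all members may be made to avoid one fixed
point, at the cost of a factor 2. The outer region is then always occupied, and having no three sets
in general position becomes `RegionFree 7`.

Erasing a point `x` from all members loses exactly as many sets as the link of `x` has. The link
allows one region fewer, because `x` can be placed in an empty region (`RegionFree.link`). So the
cubic bound follows from a quadratic bound for `RegionFree 6`, and that from a point whose link has
linear size. A link is `RegionFree 5`, but such families can be quadratic (all pairs of points), so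
the links of all points have to be compared.

In a `RegionFree 5` family all but linearly many members `T` have a canonical partition `{A, B}`,
induced by every member crossing `T`. These parts form a laminar family, so they are the linearly
many vertices of a graph with edges `{A, B}` (`RegionFree.exists_splitGraph`). After pruning low
degrees, the vertices of a component are pairwise disjoint, and an edge is determined by one point
in each end. Ranking vertices by least element, all but linearly many upward edges are good
(`card_le_card_goodEdges`). Good edges from the links of different points cannot have the same pair
of least elements, since six regions would appear (`EdgeSystem.not_isGoodPair`). So the links share
at most `|V|²` pairs, and some link is linear. -/

/-! ### Regions, erasing a point, and links. -/

/-- The cell of the Venn diagram of `X`, `Y`, `Z` that contains `p`. -/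
def vennCode {α : Type*} [DecidableEq α] (X Y Z : Finset α) (p : α) : Bool × Bool × Bool :=
  (decide (p ∈ X), decide (p ∈ Y), decide (p ∈ Z))

/-- The non-empty cells of the Venn diagram of `X`, `Y`, `Z`, the outer cell excluded. -/
def innerRegions {α : Type*} [DecidableEq α] (X Y Z : Finset α) : Finset (Bool × Bool × Bool) :=
  (X ∪ Y ∪ Z).image (vennCode X Y Z)

/-- Any three members of `F` have fewer than `k` non-empty inner regions. -/
def RegionFree {α : Type*} [DecidableEq α] (k : ℕ) (F : Finset (Finset α)) : Prop :=
  ∀ X ∈ F, ∀ Y ∈ F, ∀ Z ∈ F, (innerRegions X Y Z).card < k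

/-- The sets `A` avoiding `x` such that both `A` and `A ∪ {x}` belong to `F`. -/
def linkFamily {α : Type*} [DecidableEq α] (F : Finset (Finset α)) (x : α) : Finset (Finset α) :=
  F.filter fun A => x ∉ A ∧ insert x A ∈ F

theorem mem_linkFamily {α : Type*} [DecidableEq α] {F : Finset (Finset α)} {x : α} {A : Finset α} :
    A ∈ linkFamily F x ↔ A ∈ F ∧ x ∉ A ∧ insert x A ∈ F := by
  simp [linkFamily]

theorem mem_innerRegions {α : Type*} [DecidableEq α] {X Y Z : Finset α} {c : Bool × Bool × Bool} :
    c ∈ innerRegions X Y Z ↔ c ≠ (false, false, false) ∧ ∃ p, vennCode X Y Z p = c := by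
  simp only [innerRegions, Finset.mem_image, Finset.mem_union]
  constructor
  · rintro ⟨p, hp, rfl⟩
    refine ⟨?_, p, rfl⟩
    simp only [vennCode, ne_eq, Prod.mk.injEq, decide_eq_false_iff_not]
    tauto
  · rintro ⟨hc, p, rfl⟩
    refine ⟨p, ?_, rfl⟩
    simp only [vennCode, ne_eq, Prod.mk.injEq, decide_eq_false_iff_not] at hc
    tauto

/-- A witness for a non-empty inner region. -/
theorem mem_innerRegions_of {α : Type*} [DecidableEq α] {X Y Z : Finset α} (p : α) {a b c : Bool}
    (h : (a || b || c) = true) (hX : p ∈ X ↔ a = true) (hY : p ∈ Y ↔ b = true)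
    (hZ : p ∈ Z ↔ c = true) : (a, b, c) ∈ innerRegions X Y Z := by
  rw [mem_innerRegions]
  refine ⟨?_, p, ?_⟩
  · rintro h'
    simp only [Prod.mk.injEq] at h'
    simp [h'] at h
  · simp [vennCode, hX, hY, hZ]

/-- Erasing `x` identifies exactly the pairs `A`, `insert x A`, and the link counts these pairs. -/
theorem card_eq_image_erase_add_linkFamily {α : Type*} [DecidableEq α] (F : Finset (Finset α))
    (x : α) : F.card = (F.image fun A => A.erase x).card + (linkFamily F x).card := by
  have h1 : linkFamily F x = F.memberSubfamily x ∩ F.nonMemberSubfamily x := by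
    ext A
    simp only [mem_linkFamily, Finset.mem_inter, Finset.mem_memberSubfamily,
      Finset.mem_nonMemberSubfamily]
    tauto
  have h2 : (F.image fun A => A.erase x) = F.memberSubfamily x ∪ F.nonMemberSubfamily x := by
    ext A
    simp only [Finset.mem_image, Finset.mem_union, Finset.mem_memberSubfamily,
      Finset.mem_nonMemberSubfamily]
    constructor
    · rintro ⟨B, hB, rfl⟩
      by_cases hx : x ∈ B
      · left; simpa [Finset.insert_erase hx] using hB
      · right; simpa [Finset.erase_eq_of_notMem hx, hx] using hB
    · rintro (⟨h, hx⟩ | ⟨h, hx⟩)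
      · exact ⟨_, h, Finset.erase_insert hx⟩
      · exact ⟨_, h, Finset.erase_eq_of_notMem hx⟩
  rw [h1, h2, Finset.card_union_add_card_inter, Finset.card_memberSubfamily_add_card_nonMemberSubfamily]

theorem RegionFree.image_erase {α : Type*} [DecidableEq α] {k : ℕ} {F : Finset (Finset α)}
    (h : RegionFree k F) (x : α) : RegionFree k (F.image fun A => A.erase x) := by
  intro X hX Y hY Z hZ
  simp only [Finset.mem_image] at hX hY hZ
  obtain ⟨X, hX, rfl⟩ := hX
  obtain ⟨Y, hY, rfl⟩ := hY
  obtain ⟨Z, hZ, rfl⟩ := hZ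
  refine lt_of_le_of_lt (Finset.card_le_card ?_) (h X hX Y hY Z hZ)
  intro c hc
  simp only [innerRegions, Finset.mem_image, Finset.mem_union, Finset.mem_erase] at hc ⊢
  obtain ⟨p, hp, rfl⟩ := hc
  have hpx : p ≠ x := by tauto
  exact ⟨p, by tauto, by simp [vennCode, hpx]⟩

/-- Passing to a link, the free point can be placed in a region that was empty. -/
theorem RegionFree.link {α : Type*} [DecidableEq α] {k : ℕ} {F : Finset (Finset α)}
    (hk : k ≤ 6) (h : RegionFree (k + 1) F) (x : α) : RegionFree k (linkFamily F x) := by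
  intro X hX Y hY Z hZ
  rw [mem_linkFamily] at hX hY hZ
  by_contra! hcard
  have hlt : (innerRegions X Y Z).card <
      ((Finset.univ : Finset (Bool × Bool × Bool)).erase (false, false, false)).card := by
    have h1 : ((Finset.univ : Finset (Bool × Bool × Bool)).erase (false, false, false)).card = 7 := by
      decide
    have := h X hX.1 Y hY.1 Z hZ.1
    omega
  obtain ⟨c, hc, hc'⟩ := Finset.exists_mem_notMem_of_card_lt_card hlt
  obtain ⟨a, b, d⟩ := c
  have key : ∀ {S : Finset α} (e : Bool), S ∈ F ∧ x ∉ S ∧ insert x S ∈ F →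
      ∃ S' ∈ F, (∀ p, p ≠ x → (p ∈ S' ↔ p ∈ S)) ∧ (x ∈ S' ↔ e = true) := by
    intro S e hS
    cases e
    · exact ⟨S, hS.1, fun p _ => Iff.rfl, by simp [hS.2.1]⟩
    · exact ⟨insert x S, hS.2.2, fun p hp => by simp [hp], by simp⟩
  obtain ⟨X', hX', hX1, hX2⟩ := key a hX
  obtain ⟨Y', hY', hY1, hY2⟩ := key b hY
  obtain ⟨Z', hZ', hZ1, hZ2⟩ := key d hZ
  have hsub : insert (a, b, d) (innerRegions X Y Z) ⊆ innerRegions X' Y' Z' := by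
    intro c hc1
    rw [Finset.mem_insert] at hc1
    rcases hc1 with rfl | hc1
    · rw [mem_innerRegions]
      refine ⟨(Finset.mem_erase.1 hc).1, x, ?_⟩
      simp [vennCode, hX2, hY2, hZ2]
    · rw [mem_innerRegions] at hc1 ⊢
      obtain ⟨h0, p, rfl⟩ := hc1
      refine ⟨h0, p, ?_⟩
      have hpx : p ≠ x := by
        rintro rfl
        simp [vennCode, hX.2.1, hY.2.1, hZ.2.1] at h0
      simp [vennCode, hX1 p hpx, hY1 p hpx, hZ1 p hpx]
  have h1 := Finset.card_le_card hsub
  rw [Finset.card_insert_of_notMem hc'] at h1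
  have := h X' hX' Y' hY' Z' hZ'
  omega

/-! ### Crossing sets and a linear bound. -/

/-- Two sets cross if both differences and the intersection are non-empty. -/
def Crosses {α : Type*} [DecidableEq α] (X Y : Finset α) : Prop :=
  (X ∩ Y).Nonempty ∧ (X \ Y).Nonempty ∧ (Y \ X).Nonempty

theorem Crosses.symm {α : Type*} [DecidableEq α] {X Y : Finset α} (h : Crosses X Y) :
    Crosses Y X :=
  ⟨by rw [Finset.inter_comm]; exact h.1, h.2.2, h.2.1⟩

/-- If the sets crossing a given member all leave the same remainder outside it, the family is
linear in size. -/
theorem card_le_of_crosses_sdiff_eq {α : Type*} [DecidableEq α] (V : Finset α) :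
    ∀ P : Finset (Finset α), (∀ T ∈ P, T ⊆ V) →
      (∀ T ∈ P, ∀ Z ∈ P, ∀ Z' ∈ P, Crosses T Z → Crosses T Z' → Z \ T = Z' \ T) →
      P.card ≤ 4 * V.card + 1 := by
  induction V using Finset.induction_on with
  | empty =>
    intro P hV _
    have : P ⊆ {∅} := fun T hT => by simpa using hV T hT
    simpa using Finset.card_le_card this
  | insert p V hp ih =>
    intro P hV hP
    rw [card_eq_image_erase_add_linkFamily P p, Finset.card_insert_of_notMem hp]
    have h1 := ih (P.image fun A => A.erase p) (by
        intro T hT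
        simp only [Finset.mem_image] at hT
        obtain ⟨T, hT, rfl⟩ := hT
        intro q hq
        have := hV T hT (Finset.mem_of_mem_erase hq)
        exact Finset.mem_of_mem_insert_of_ne this (Finset.ne_of_mem_erase hq)) (by
        intro T hT Z hZ Z' hZ' h h'
        simp only [Finset.mem_image] at hT hZ hZ'
        obtain ⟨T, hT, rfl⟩ := hT
        obtain ⟨Z, hZ, rfl⟩ := hZ
        obtain ⟨Z', hZ', rfl⟩ := hZ'
        have key : ∀ {S S' : Finset α}, Crosses (S.erase p) (S'.erase p) → Crosses S S' := by
          rintro S S' ⟨⟨a, ha⟩, ⟨b, hb⟩, ⟨c, hc⟩⟩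
          simp only [Finset.mem_inter, Finset.mem_sdiff, Finset.mem_erase] at ha hb hc
          refine ⟨⟨a, ?_⟩, ⟨b, ?_⟩, ⟨c, ?_⟩⟩ <;>
            simp only [Finset.mem_inter, Finset.mem_sdiff] <;> tauto
        have := hP T hT Z hZ Z' hZ' (key h) (key h')
        ext q
        have := Finset.ext_iff.1 this q
        simp only [Finset.mem_sdiff, Finset.mem_erase] at this ⊢
        tauto)
    -- The four are `∅`, a minimal non-empty member `A`, at most one further member containing `A`,
    -- and at most one disjoint from `A`.
    have h2 : (linkFamily P p).card ≤ 4 := by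
      by_contra! hcard
      set R := (linkFamily P p).erase ∅ with hR
      have hRcard : 4 ≤ R.card := by
        have : (linkFamily P p).card - 1 ≤ R.card := Finset.pred_card_le_card_erase
        omega
      have hRne : R.Nonempty := Finset.card_pos.1 (by omega)
      obtain ⟨A, hAR, hAmin⟩ := R.exists_minimal hRne
      have hmem : ∀ B ∈ R, B.Nonempty ∧ B ∈ P ∧ p ∉ B ∧ insert p B ∈ P := by
        intro B hB
        rw [hR, Finset.mem_erase, mem_linkFamily] at hB
        exact ⟨Finset.nonempty_iff_ne_empty.2 hB.1, hB.2⟩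
      obtain ⟨hA0, hA1, hA2, hA3⟩ := hmem A hAR
      -- every other member contains `A` or is disjoint from it
      have hcase : ∀ B ∈ R, B ≠ A → A ⊆ B ∨ Disjoint A B := by
        intro B hB hBA
        obtain ⟨hB0, hB1, hB2, hB3⟩ := hmem B hB
        by_contra! hcon
        obtain ⟨hc1, hc2⟩ := hcon
        rw [Finset.not_disjoint_iff] at hc2
        obtain ⟨a, ha, ha'⟩ := hc2
        have hBnA : ¬ B ⊆ A := fun h => hBA (le_antisymm h (hAmin hB h))
        obtain ⟨b, hb, hb'⟩ := Finset.not_subset.1 hc1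
        obtain ⟨c, hc, hc'⟩ := Finset.not_subset.1 hBnA
        have e := hP A hA1 B hB1 (insert p B) hB3
          ⟨⟨a, by simp [ha, ha']⟩, ⟨b, by simp [hb, hb']⟩, ⟨c, by simp [hc, hc']⟩⟩
          ⟨⟨a, by simp [ha, ha']⟩, ⟨b, by
            have : b ≠ p := by rintro rfl; exact hA2 hb
            simp [hb, hb', this]⟩, ⟨c, by simp [hc, hc']⟩⟩
        have := Finset.ext_iff.1 e p
        simp [hA2, hB2] at this
      have hsup : ∀ B ∈ R, B ≠ A → A ⊆ B → Crosses (insert p A) B := by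
        intro B hB hBA h
        obtain ⟨hB0, hB1, hB2, hB3⟩ := hmem B hB
        obtain ⟨a, ha⟩ := hA0
        obtain ⟨b, hb, hb'⟩ := Finset.not_subset.1 fun h' => hBA (le_antisymm h' h)
        have hbp : b ≠ p := by rintro rfl; exact hB2 hb
        exact ⟨⟨a, by simp [ha, h ha]⟩, ⟨p, by simp [hB2]⟩, ⟨b, by simp [hb, hb', hbp]⟩⟩
      have hdis : ∀ B ∈ R, Disjoint A B → Crosses (insert p A) (insert p B) := by
        intro B hB h
        obtain ⟨⟨b, hb⟩, hB1, hB2, hB3⟩ := hmem B hB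
        obtain ⟨a, ha⟩ := hA0
        have hbp : b ≠ p := by rintro rfl; exact hB2 hb
        have hap : a ≠ p := by rintro rfl; exact hA2 ha
        exact ⟨⟨p, by simp⟩, ⟨a, by simp [ha, hap, Finset.disjoint_left.1 h ha]⟩,
          ⟨b, by simp [hb, hbp, Finset.disjoint_right.1 h hb]⟩⟩
      -- All these supersets cross `insert p A`, so they agree outside it. They also agree on `A`
      -- and at `p`.
      have hs : ((R.erase A).filter fun B => A ⊆ B).card ≤ 1 := by
        rw [Finset.card_le_one]
        intro B hB C hC
        simp only [Finset.mem_filter, Finset.mem_erase] at hB hC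
        have e := hP _ hA3 B (hmem B hB.1.2).2.1 C (hmem C hC.1.2).2.1
          (hsup B hB.1.2 hB.1.1 hB.2) (hsup C hC.1.2 hC.1.1 hC.2)
        ext q
        have := Finset.ext_iff.1 e q
        by_cases hq : q = p
        · subst hq
          simp [(hmem B hB.1.2).2.2.1, (hmem C hC.1.2).2.2.1]
        · by_cases hqA : q ∈ A
          · simp [hB.2 hqA, hC.2 hqA]
          · simpa [hq, hqA] using this
      have hd : ((R.erase A).filter fun B => ¬ A ⊆ B).card ≤ 1 := by
        rw [Finset.card_le_one]
        intro B hB C hC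
        simp only [Finset.mem_filter, Finset.mem_erase] at hB hC
        have dB := (hcase B hB.1.2 hB.1.1).resolve_left hB.2
        have dC := (hcase C hC.1.2 hC.1.1).resolve_left hC.2
        have e := hP _ hA3 _ (hmem B hB.1.2).2.2.2 _ (hmem C hC.1.2).2.2.2
          (hdis B hB.1.2 dB) (hdis C hC.1.2 dC)
        ext q
        have := Finset.ext_iff.1 e q
        by_cases hq : q = p
        · subst hq
          simp [(hmem B hB.1.2).2.2.1, (hmem C hC.1.2).2.2.1]
        · by_cases hqA : q ∈ A
          · simp [Finset.disjoint_left.1 dB hqA, Finset.disjoint_left.1 dC hqA]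
          · simpa [hq, hqA] using this
      have h3 := Finset.card_filter_add_card_filter_not (s := R.erase A) fun B => A ⊆ B
      have h4 := Finset.card_erase_of_mem hAR
      omega
    omega

/-! ### Edge systems, and edges shared by the links of two points. -/

/-- A graph, given by its ordered pairs of adjacent vertices, whose vertices are sets and whose
edges `{A, B}` split members `A ∪ B` of the link of `x` in `G`. -/
structure EdgeSystem {α : Type*} [DecidableEq α] (G : Finset (Finset α)) (x : α)
    (E : Finset (Finset α × Finset α)) : Prop where
  mem : ∀ {A B}, (A, B) ∈ E → A ∪ B ∈ linkFamily G x
  nonempty : ∀ {A B}, (A, B) ∈ E → A.Nonempty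
  symm : ∀ {A B}, (A, B) ∈ E → (B, A) ∈ E
  ne : ∀ {A B}, (A, B) ∈ E → A ≠ B
  degree : ∀ {A B}, (A, B) ∈ E → 6 ≤ (E.filter fun e => e.1 = A).card
  component : ∀ {A B}, Relation.ReflTransGen (fun C D => (C, D) ∈ E) A B → A = B ∨ Disjoint A B

/-- Three members of a `6`-region-free family cannot exhibit six regions. -/
theorem RegionFree.false_of_subset {α : Type*} [DecidableEq α] {G : Finset (Finset α)}
    (hG : RegionFree 6 G) {X Y Z : Finset α} (hX : X ∈ G) (hY : Y ∈ G) (hZ : Z ∈ G)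
    (S : Finset (Bool × Bool × Bool)) (hS : S.card = 6) (h : ∀ c ∈ S, c ∈ innerRegions X Y Z) :
    False := by
  have := Finset.card_le_card (show S ⊆ innerRegions X Y Z from h)
  have := hG X hX Y hY Z hZ
  omega

/-- Two disjoint members of the link of `x` cannot both be split by a member of the family that has
a further point besides `x`. -/
theorem RegionFree.false_of_split {α : Type*} [DecidableEq α] {G : Finset (Finset α)}
    (hG : RegionFree 6 G) {x : α} {X Y W : Finset α} (hX : X ∈ linkFamily G x)
    (hY : Y ∈ linkFamily G x) (hXY : Disjoint X Y) (hW : W ∈ G)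
    (h1 : ∃ p ∈ X, p ∈ W) (h2 : ∃ p ∈ X, p ∉ W) (h3 : ∃ p ∈ Y, p ∈ W) (h4 : ∃ p ∈ Y, p ∉ W)
    {w : α} (hw : w ∈ W) (hwx : w ≠ x) (hwX : w ∉ X) (hwY : w ∉ Y) : False := by
  obtain ⟨p1, h1, h1'⟩ := h1
  obtain ⟨p2, h2, h2'⟩ := h2
  obtain ⟨p3, h3, h3'⟩ := h3
  obtain ⟨p4, h4, h4'⟩ := h4
  rw [mem_linkFamily] at hX hY
  have d := Finset.disjoint_left.1 hXY
  have d' := Finset.disjoint_right.1 hXY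
  have e : ∀ {p : α}, p ∈ X → p ≠ x := fun hp h => hX.2.1 (h ▸ hp)
  have e' : ∀ {p : α}, p ∈ Y → p ≠ x := fun hp h => hY.2.1 (h ▸ hp)
  -- Adding `x` to both of the disjoint sets creates a common region, the sixth one, whether or not
  -- `x` lies in `W`.
  refine hG.false_of_subset hX.2.2 hY.2.2 hW {(true, false, true), (true, false, false),
    (false, true, true), (false, true, false), (false, false, true), (true, true, decide (x ∈ W))}
    ?_ ?_
  · by_cases h : x ∈ W <;> simp only [h, decide_true, decide_false] <;> decide
  · simp only [Finset.mem_insert, Finset.mem_singleton, forall_eq_or_imp, forall_eq]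
    refine ⟨mem_innerRegions_of p1 rfl ?_ ?_ ?_, mem_innerRegions_of p2 rfl ?_ ?_ ?_,
      mem_innerRegions_of p3 rfl ?_ ?_ ?_, mem_innerRegions_of p4 rfl ?_ ?_ ?_,
      mem_innerRegions_of w rfl ?_ ?_ ?_, mem_innerRegions_of x rfl ?_ ?_ ?_⟩
    · simp [h1]
    · simp [d h1, e h1]
    · simp [h1']
    · simp [h2]
    · simp [d h2, e h2]
    · simp [h2']
    · simp [d' h3, e' h3]
    · simp [h3]
    · simp [h3']
    · simp [d' h4, e' h4]
    · simp [h4]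
    · simp [h4']
    · simp [hwx, hwX]
    · simp [hwx, hwY]
    · simp [hw]
    · simp
    · simp
    · simp

namespace EdgeSystem

variable {α : Type*} [DecidableEq α] {G : Finset (Finset α)} {x : α}
  {E : Finset (Finset α × Finset α)}

theorem disjoint_of_reach (hE : EdgeSystem G x E) {A B : Finset α}
    (h : Relation.ReflTransGen (fun C D => (C, D) ∈ E) A B) (hne : A ≠ B) : Disjoint A B :=
  (hE.component h).resolve_left hne

theorem disjoint (hE : EdgeSystem G x E) {A B : Finset α} (h : (A, B) ∈ E) : Disjoint A B :=
  hE.disjoint_of_reach (.single h) (hE.ne h)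

theorem notMem_left (hE : EdgeSystem G x E) {A B : Finset α} (h : (A, B) ∈ E) : x ∉ A :=
  fun hx => (mem_linkFamily.1 (hE.mem h)).2.1 (Finset.mem_union_left _ hx)

theorem reach_symm (hE : EdgeSystem G x E) {A B : Finset α}
    (h : Relation.ReflTransGen (fun C D => (C, D) ∈ E) A B) :
    Relation.ReflTransGen (fun C D => (C, D) ∈ E) B A := by
  induction h with
  | refl => exact .refl
  | tail _ h ih => exact .head (hE.symm h) ih

/-- A vertex has a neighbour different from few given vertices and avoiding few given points. -/
theorem exists_nbr (hE : EdgeSystem G x E) {A B : Finset α} (h : (A, B) ∈ E)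
    (forb : Finset (Finset α)) (pts : Finset α) (hc : forb.card + pts.card ≤ 5) :
    ∃ C, (A, C) ∈ E ∧ C ∉ forb ∧ ∀ p ∈ pts, p ∉ C := by
  by_contra! hcon
  have hch : ∀ e ∈ E.filter fun e => e.1 = A, e.2 ∉ forb → ∃ p ∈ pts, p ∈ e.2 := by
    rintro ⟨A', C⟩ he hC
    rw [Finset.mem_filter] at he
    obtain ⟨he, rfl⟩ := he
    exact hcon C he hC
  have h6 := hE.degree h
  rw [← Finset.card_filter_add_card_filter_not (s := E.filter fun e => e.1 = A)
    (fun e => e.2 ∈ forb)] at h6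
  -- There are six neighbours, pairwise disjoint: each forbidden vertex and each forbidden point
  -- excludes at most one of them.
  have h1 : ((E.filter fun e => e.1 = A).filter fun e => e.2 ∈ forb).card ≤ forb.card := by
    refine Finset.card_le_card_of_injOn Prod.snd (fun e he => (Finset.mem_filter.1 he).2) ?_
    rintro ⟨a, c⟩ he ⟨a', c'⟩ he' hcc
    simp only [Finset.coe_filter, Finset.mem_filter, Set.mem_ofPred_eq] at he he' hcc
    rw [he.1.2, he'.1.2, hcc]
  have h2 : ((E.filter fun e => e.1 = A).filter fun e => ¬ e.2 ∈ forb).card ≤ pts.card := by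
    refine Finset.card_le_card_of_forall_subsingleton (fun e p => p ∈ e.2) ?_ ?_
    · intro e he
      exact hch e (Finset.mem_filter.1 he).1 (Finset.mem_filter.1 he).2
    · rintro p - ⟨a, c⟩ ⟨he, hp⟩ ⟨a', c'⟩ ⟨he', hp'⟩
      simp only [Finset.mem_filter] at he he' hp hp'
      obtain ⟨⟨he, rfl⟩, -⟩ := he
      obtain ⟨⟨he', rfl⟩, -⟩ := he'
      by_contra hne
      have hne' : c ≠ c' := fun h => hne (by rw [h])
      exact Finset.disjoint_left.1 (hE.disjoint_of_reach
        (.head (hE.symm he) (.single he')) hne') hp hp'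
  omega

/-- Two edges of the same component without common vertex cannot both be split by a member of the
family that has a further point besides `x`. -/
theorem false_of_split (hE : EdgeSystem G x E) (hG : RegionFree 6 G) {A B C D W : Finset α}
    (hAB : (A, B) ∈ E) (hCD : (C, D) ∈ E)
    (hr : Relation.ReflTransGen (fun C D => (C, D) ∈ E) B C)
    (hAC : A ≠ C) (hAD : A ≠ D) (hBC : B ≠ C) (hBD : B ≠ D) (hW : W ∈ G)
    (h1 : ∃ p ∈ A ∪ B, p ∈ W) (h2 : ∃ p ∈ A ∪ B, p ∉ W) (h3 : ∃ p ∈ C ∪ D, p ∈ W)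
    (h4 : ∃ p ∈ C ∪ D, p ∉ W) {w : α} (hw : w ∈ W) (hwx : w ≠ x) (hwA : w ∉ A) (hwB : w ∉ B)
    (hwC : w ∉ C) (hwD : w ∉ D) : False := by
  refine hG.false_of_split (hE.mem hAB) (hE.mem hCD) ?_ hW h1 h2 h3 h4 hw hwx
    (by simp [hwA, hwB]) (by simp [hwC, hwD])
  have hr' := Relation.ReflTransGen.head hAB hr
  simp only [Finset.disjoint_union_left, Finset.disjoint_union_right]
  exact ⟨⟨hE.disjoint_of_reach hr' hAC, hE.disjoint_of_reach hr hBC⟩,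
    hE.disjoint_of_reach (hr'.tail hCD) hAD, hE.disjoint_of_reach (hr.tail hCD) hBD⟩

/-- A member of the family meeting both ends of an edge `{A, B}` is contained in `A ∪ B`, up to
`x`, if `B` has enough neighbours not covered by the member and reachable from `A` avoiding `B`. -/
theorem mem_union_of_mem (hE : EdgeSystem G x E) (hG : RegionFree 6 G) {A B W : Finset α}
    (hAB : (A, B) ∈ E) (hW : W ∈ G) {a b : α} (ha : a ∈ A) (haW : a ∈ W) (hb : b ∈ B)
    (hbW : b ∈ W) (N : Finset (Finset α)) (hN : 3 ≤ N.card)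
    (hNE : ∀ D ∈ N, (B, D) ∈ E ∧ ¬ D ⊆ W ∧
      Relation.ReflTransGen (fun C D => (C, D) ∈ E ∧ C ≠ B ∧ D ≠ B) A D)
    {w : α} (hw : w ∈ W) (hwx : w ≠ x) : w ∈ A ∪ B := by
  by_contra hwAB
  simp only [Finset.mem_union, not_or] at hwAB
  obtain ⟨hwA, hwB⟩ := hwAB
  have hax : a ≠ x := fun h => hE.notMem_left hAB (h ▸ ha)
  have hneAB := hE.ne hAB
  -- choosing a neighbour of `B` in `N`
  have hpick : ∀ D : Finset α, ∀ q : α, ∃ C ∈ N, C ≠ D ∧ q ∉ C := by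
    intro D q
    by_contra! hcon
    have h1 : (N.erase D).card ≤ 1 := by
      rw [Finset.card_le_one]
      intro C hC C' hC'
      rw [Finset.mem_erase] at hC hC'
      by_contra hne
      exact Finset.disjoint_left.1 (hE.disjoint_of_reach
        (.head (hE.symm (hNE C hC.2).1) (.single (hNE C' hC'.2).1)) hne)
        (hcon C hC.2 hC.1) (hcon C' hC'.2 hC'.1)
    have := Finset.pred_card_le_card_erase (s := N) (a := D)
    omega
  have hsub : ∀ {D : Finset α}, ¬ D ⊆ W → ∃ p ∈ D, p ∉ W := fun h => Finset.not_subset.1 h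
  by_cases hAW : A ⊆ W
  -- The path from `A`, covered by `W`, to an uncovered neighbour of `B` has an edge where coverage
  -- stops. `W` splits that edge.
  · obtain ⟨C, D, hAC, hCD, hCB, hDB, hCW, hDW⟩ : ∃ C D,
        Relation.ReflTransGen (fun C D => (C, D) ∈ E) A C ∧ (C, D) ∈ E ∧ C ≠ B ∧ D ≠ B ∧
        C ⊆ W ∧ ¬ D ⊆ W := by
      obtain ⟨D, hD⟩ := Finset.card_pos.1 (show 0 < N.card by omega)
      obtain ⟨-, hDW, hr⟩ := hNE D hD
      clear hD
      induction hr with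
      | refl => exact absurd hAW hDW
      | @tail C D hr h ih =>
        by_cases hCW : C ⊆ W
        · exact ⟨C, D, Relation.ReflTransGen.mono (fun _ _ h => h.1) _ _ hr, h.1, h.2.1, h.2.2, hCW, hDW⟩
        · exact ih hCW
    obtain ⟨c, hc⟩ := hE.nonempty hCD
    obtain ⟨d, hd, hdW⟩ := hsub hDW
    have hDA : D ≠ A := by rintro rfl; exact hDW hAW
    have haD : a ∉ D := fun h =>
      Finset.disjoint_left.1 (hE.disjoint_of_reach (hAC.tail hCD) hDA.symm) ha h
    have haB : a ∉ B := Finset.disjoint_left.1 (hE.disjoint hAB) ha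
    -- Otherwise `a` itself is a further point of `W` outside both `{C, D}` and an edge `{B, F}`.
    have hCA : C = A := by
      by_contra hne
      obtain ⟨F, hF, hFD, -⟩ := hpick D a
      obtain ⟨hBF, hFW, -⟩ := hNE F hF
      obtain ⟨f, hf, hfW⟩ := hsub hFW
      have hFA : A ≠ F := by rintro rfl; exact hFW hAW
      refine hE.false_of_split hG hCD hBF
        ((hE.reach_symm (hAC.tail hCD)).tail hAB) hCB ?_ hDB hFD.symm hW
        ⟨c, by simp [hc], hCW hc⟩ ⟨d, by simp [hd], hdW⟩ ⟨b, by simp [hb], hbW⟩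
        ⟨f, by simp [hf], hfW⟩ haW hax ?_ haD haB ?_
      · rintro rfl; exact hFW hCW
      · exact Finset.disjoint_left.1 (hE.disjoint_of_reach hAC (Ne.symm hne)) ha
      · exact Finset.disjoint_left.1 (hE.disjoint_of_reach (.head hAB (.single hBF)) hFA) ha
    subst hCA
    obtain ⟨F, hF, hFD, hwF⟩ := hpick D w
    obtain ⟨hBF, hFW, -⟩ := hNE F hF
    obtain ⟨f, hf, hfW⟩ := hsub hFW
    have hFC : C ≠ F := by rintro rfl; exact hFW hAW
    -- If `w ∈ D`, then `D` alone is already split, so `{C, D}` can be replaced by an edge `{D, I}`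
    -- that leaves `a` as the further point.
    by_cases hwD : w ∈ D
    · obtain ⟨I, hDI, hI, -⟩ := hE.exists_nbr (hE.symm hCD) {C, B, F} ∅ (by
        rw [Finset.card_empty, add_zero]
        exact (Finset.card_le_three).trans (by norm_num))
      simp only [Finset.mem_insert, Finset.mem_singleton, not_or] at hI
      refine hE.false_of_split hG hDI hBF
        (.head (hE.symm hDI) (.head (hE.symm hCD) (.single hAB))) hDB hFD.symm hI.2.1 hI.2.2 hW
        ⟨w, by simp [hwD], hw⟩ ⟨d, by simp [hd], hdW⟩ ⟨b, by simp [hb], hbW⟩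
        ⟨f, by simp [hf], hfW⟩ haW hax haD ?_ haB ?_
      · exact Finset.disjoint_left.1 (hE.disjoint_of_reach (.head hCD (.single hDI))
          (Ne.symm hI.1)) ha
      · exact Finset.disjoint_left.1 (hE.disjoint_of_reach (.head hAB (.single hBF)) hFC) ha
    · exact hE.false_of_split hG hCD hBF (.head (hE.symm hCD) (.single hAB)) hCB hFC hDB
        hFD.symm hW ⟨c, by simp [hc], hCW hc⟩ ⟨d, by simp [hd], hdW⟩ ⟨b, by simp [hb], hbW⟩
        ⟨f, by simp [hf], hfW⟩ hw hwx hwA hwD hwB hwF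
  · obtain ⟨p, hp, hpW⟩ := hsub hAW
    obtain ⟨F, hF, hFA, hwF⟩ := hpick A w
    obtain ⟨hBF, hFW, -⟩ := hNE F hF
    obtain ⟨f, hf, hfW⟩ := hsub hFW
    obtain ⟨I, hAI, hI, hwI⟩ := hE.exists_nbr hAB {B, F} {w} (by
      have := Finset.card_le_two (a := B) (b := F)
      rw [Finset.card_singleton]; omega)
    simp only [Finset.mem_insert, Finset.mem_singleton, not_or, forall_eq] at hI hwI
    exact hE.false_of_split hG hAI hBF (.head (hE.symm hAI) (.single hAB)) hneAB
      hFA.symm hI.1 hI.2 hW ⟨a, by simp [ha], haW⟩ ⟨p, by simp [hp], hpW⟩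
      ⟨b, by simp [hb], hbW⟩ ⟨f, by simp [hf], hfW⟩ hw hwx hwA hwI hwB hwF

theorem disjoint_edges (hE : EdgeSystem G x E) {A B C D : Finset α} (hAB : (A, B) ∈ E)
    (hAC : (A, C) ∈ E) (hBD : (B, D) ∈ E) (hCB : C ≠ B) (hDA : D ≠ A) (hCD : C ≠ D) :
    Disjoint (A ∪ C) (B ∪ D) := by
  simp only [Finset.disjoint_union_left, Finset.disjoint_union_right]
  have h := Relation.ReflTransGen.single (r := fun C D => (C, D) ∈ E) (hE.symm hAC)
  exact ⟨⟨hE.disjoint hAB, hE.disjoint_of_reach (h.tail hAB) hCB⟩,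
    hE.disjoint_of_reach (.head hAB (.single hBD)) hDA.symm,
    hE.disjoint_of_reach ((h.tail hAB).tail hBD) hCD⟩

variable {x' : α} {E' : Finset (Finset α × Finset α)}

/-- Extend `A` and `B` by neighbours `C` and `D` that miss `x'`. The set `insert x' (A' ∪ B')`
splits both `A ∪ C` and `B ∪ D`, and `x'` is its further point. -/
theorem false_of_shared_of_notMem (hE : EdgeSystem G x E) (hE' : EdgeSystem G x' E')
    (hG : RegionFree 6 G) (hxx : x ≠ x') {A B A' B' : Finset α} (hAB : (A, B) ∈ E)
    (hAB' : (A', B') ∈ E') {y z : α} (hy : y ∈ A) (hy' : y ∈ A') (hz : z ∈ B) (hz' : z ∈ B')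
    (h1 : ∀ w ∈ A' ∪ B', w ≠ x → w ∈ A ∪ B) (hx' : x' ∉ A ∪ B) : False := by
  obtain ⟨C, hAC, hCB, hC⟩ := hE.exists_nbr hAB {B} {x'} (by simp)
  obtain ⟨D, hBD, hDA, hD⟩ := hE.exists_nbr (hE.symm hAB) {A, C} {x'} (by
    have := Finset.card_le_two (a := A) (b := C)
    rw [Finset.card_singleton]; omega)
  simp only [Finset.mem_insert, Finset.mem_singleton, not_or, forall_eq, Finset.mem_union] at *
  obtain ⟨c, hc⟩ := hE.nonempty (hE.symm hAC)
  obtain ⟨d, hd⟩ := hE.nonempty (hE.symm hBD)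
  have hdisj := hE.disjoint_edges hAB hAC hBD hCB hDA.1 (Ne.symm hDA.2)
  have hAC' := Finset.disjoint_left.1 (hE.disjoint hAC)
  have hBD' := Finset.disjoint_left.1 (hE.disjoint hBD)
  have hdd : ∀ p, p ∈ A ∪ C → p ∉ B ∪ D := fun p h => Finset.disjoint_left.1 hdisj h
  simp only [Finset.mem_union, not_or] at hdd
  have hout : ∀ p, (p ∈ C ∨ p ∈ D) → p ∉ insert x' (A' ∪ B') := by
    intro p hp hpW
    have hpx : p ≠ x := by
      rintro rfl
      rcases hp with hp | hp
      · exact hE.notMem_left (hE.symm hAC) hp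
      · exact hE.notMem_left (hE.symm hBD) hp
    simp only [Finset.mem_insert, Finset.mem_union] at hpW
    rcases hpW with rfl | hpW
    · exact hp.elim hC hD
    · have h3 := h1 p hpW hpx
      rcases hp with hp | hp
      · rcases h3 with h3 | h3
        · exact hAC' h3 hp
        · exact (hdd p (.inr hp)).1 h3
      · rcases h3 with h3 | h3
        · exact (hdd p (.inl h3)).2 hp
        · exact hBD' h3 hp
  refine hG.false_of_split (hE.mem hAC) (hE.mem hBD) hdisj
    (mem_linkFamily.1 (hE'.mem hAB')).2.2 ⟨y, by simp [hy], by simp [hy']⟩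
    ⟨c, by simp [hc], hout c (.inl hc)⟩ ⟨z, by simp [hz], by simp [hz']⟩
    ⟨d, by simp [hd], hout d (.inr hd)⟩ (Finset.mem_insert_self x' _) (Ne.symm hxx) ?_ ?_
  · simp [hx', hC]
  · simp [hx', hD]

/-- Here the two unions agree up to `x` and `x'`. The six regions come from `A ∪ C` and `B ∪ D`,
each with `x` added, and `A' ∪ K` with `x'` added, for neighbours `C`, `D`, `K` of `A`, `B`, `A'`.
-/
theorem false_of_shared_of_mem (hE : EdgeSystem G x E) (hE' : EdgeSystem G x' E')
    (hG : RegionFree 6 G) (hxx : x ≠ x') {A B A' B' : Finset α} (hAB : (A, B) ∈ E)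
    (hAB' : (A', B') ∈ E') {y z : α} (hy : y ∈ A) (hy' : y ∈ A') (hz : z ∈ B) (hz' : z ∈ B')
    (h1 : ∀ w ∈ A' ∪ B', w ≠ x → w ∈ A ∪ B) (h2 : ∀ w ∈ A ∪ B, w ≠ x' → w ∈ A' ∪ B')
    (hx' : x' ∈ B) : False := by
  obtain ⟨P, hAP, hPB, hP⟩ := hE'.exists_nbr hAB' {B'} {x} (by simp)
  obtain ⟨Q, hAQ, hQB, hQ⟩ := hE'.exists_nbr hAB' {B', P} {x} (by
    have := Finset.card_le_two (a := B') (b := P)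
    rw [Finset.card_singleton]; omega)
  simp only [Finset.mem_insert, Finset.mem_singleton, not_or, forall_eq] at hPB hP hQB hQ
  obtain ⟨p, hp⟩ := hE'.nonempty (hE'.symm hAP)
  obtain ⟨q, hq⟩ := hE'.nonempty (hE'.symm hAQ)
  have hpq2 := Finset.card_le_two (a := p) (b := q)
  obtain ⟨C, hAC, hCB, hC⟩ := hE.exists_nbr hAB {B} {p, q} (by
    rw [Finset.card_singleton]; omega)
  have hAC2 := Finset.card_le_two (a := A) (b := C)
  obtain ⟨D, hBD, hDA, hD⟩ := hE.exists_nbr (hE.symm hAB) {A, C} {p, q} (by omega)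
  simp only [Finset.mem_insert, Finset.mem_singleton, not_or, forall_eq_or_imp, forall_eq]
    at hCB hC hDA hD
  obtain ⟨c, hc⟩ := hE.nonempty (hE.symm hAC)
  -- `P` and `Q` are disjoint, so one of them avoids `c`. Both `C` and `D` were chosen to avoid `p`
  -- and `q`.
  obtain ⟨K, k, hAK, hKB, hxK, hk, hcK, hkC, hkD⟩ : ∃ K k, (A', K) ∈ E' ∧ K ≠ B' ∧ x ∉ K ∧ k ∈ K ∧
      c ∉ K ∧ k ∉ C ∧ k ∉ D := by
    by_cases hcP : c ∈ P
    · refine ⟨Q, q, hAQ, hQB.1, hQ, hq, ?_, hC.2, hD.2⟩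
      exact Finset.disjoint_left.1 (hE'.disjoint_of_reach (.head (hE'.symm hAP) (.single hAQ))
        (Ne.symm hQB.2)) hcP
    · exact ⟨P, p, hAP, hPB, hP, hp, hcP, hC.1, hD.1⟩
  have hdisj := hE.disjoint_edges hAB hAC hBD hCB hDA.1 (Ne.symm hDA.2)
  have hAC' := Finset.disjoint_left.1 (hE.disjoint hAC)
  have hAK' := Finset.disjoint_left.1 (hE'.disjoint hAK)
  have hAB1 := Finset.disjoint_left.1 (hE'.disjoint hAB')
  have hBK := Finset.disjoint_left.1 (hE'.disjoint_of_reach (.head (hE'.symm hAB') (.single hAK))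
    hKB.symm)
  have hdd : ∀ p, p ∈ A ∪ C → p ∉ B ∪ D := fun p h => Finset.disjoint_left.1 hdisj h
  simp only [Finset.mem_union, not_or] at hdd h1 h2
  have hxA := hE.notMem_left hAB
  have hxB := hE.notMem_left (hE.symm hAB)
  have hxC := hE.notMem_left (hE.symm hAC)
  have hxD := hE.notMem_left (hE.symm hBD)
  have hxA' := hE'.notMem_left hAB'
  have hxB' := hE'.notMem_left (hE'.symm hAB')
  have hxK' := hE'.notMem_left (hE'.symm hAK)
  have hne : ∀ {u v : α} {S : Finset α}, u ∈ S → v ∉ S → u ≠ v := fun h h' e => h' (e ▸ h)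
  have hyB := (hdd y (.inl hy)).1
  have hyD := (hdd y (.inl hy)).2
  have hzAC : z ∉ A ∧ z ∉ C := ⟨fun h => (hdd z (.inl h)).1 hz, fun h => (hdd z (.inr h)).1 hz⟩
  have hcB := (hdd c (.inr hc)).1
  have hcD := (hdd c (.inr hc)).2
  have hcA : c ∉ A := fun h => hAC' h hc
  have hcA' : c ∉ A' := fun h => (h1 c (.inl h) (hne hc hxC)).elim hcA hcB
  have hkAB : k ∉ A ∧ k ∉ B := by
    have hk1 : ¬ (k ∈ A' ∨ k ∈ B') := fun h => h.elim (fun h => hAK' h hk) (fun h => hBK h hk)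
    exact ⟨fun h => hk1 (h2 k (.inl h) (hne hk hxK')), fun h => hk1 (h2 k (.inr h) (hne hk hxK'))⟩
  have hxac : x' ∉ A ∧ x' ∉ C :=
    ⟨fun h => (hdd _ (.inl h)).1 hx', fun h => (hdd _ (.inr h)).1 hx'⟩
  have hmX := (mem_linkFamily.1 (hE.mem hAC)).2.2
  have hmY := (mem_linkFamily.1 (hE.mem hBD)).2.2
  have hmZ := (mem_linkFamily.1 (hE'.mem hAK)).2.2
  have hzK : z ∉ K := hBK hz'
  have hzA' : z ∉ A' := fun h => hAB1 h hz'
  refine hG.false_of_subset hmX hmY hmZ {(true, false, true), (false, true, false),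
    (true, false, false), (false, false, true), (false, true, true),
    (true, true, decide (x ∈ insert x' (A' ∪ K)))} ?_ ?_
  · by_cases h : x ∈ insert x' (A' ∪ K) <;> simp only [h, decide_true, decide_false] <;> decide
  · simp only [Finset.mem_insert, Finset.mem_singleton, forall_eq_or_imp, forall_eq]
    refine ⟨mem_innerRegions_of y rfl ?_ ?_ ?_, mem_innerRegions_of z rfl ?_ ?_ ?_,
      mem_innerRegions_of c rfl ?_ ?_ ?_, mem_innerRegions_of k rfl ?_ ?_ ?_,
      mem_innerRegions_of x' rfl ?_ ?_ ?_, mem_innerRegions_of x rfl ?_ ?_ ?_⟩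
    · simp [hy]
    · simp [hyB, hyD, hne hy hxA]
    · simp [hy']
    · simp [hzAC, hne hz hxB]
    · simp [hz]
    · simp [hzA', hzK, hne hz' hxB']
    · simp [hc]
    · simp [hcB, hcD, hne hc hxC]
    · simp [hcA', hcK, (hne hx' hcB).symm]
    · simp [hkAB, hkC, hne hk hxK]
    · simp [hkAB, hkD, hne hk hxK]
    · simp [hk]
    · simp [hxac, hxx.symm]
    · simp [hx']
    · simp
    · simp
    · simp
    · simp

/-- Edges belonging to the links of different points cannot meet in both of their ends, if each is
well connected outside the other. -/
theorem false_of_shared (hE : EdgeSystem G x E) (hE' : EdgeSystem G x' E')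
    (hG : RegionFree 6 G) (hxx : x ≠ x') {A B A' B' : Finset α} (hAB : (A, B) ∈ E)
    (hAB' : (A', B') ∈ E') {y z : α} (hy : y ∈ A) (hy' : y ∈ A') (hz : z ∈ B) (hz' : z ∈ B')
    (N : Finset (Finset α)) (hN : 3 ≤ N.card)
    (hNE : ∀ D ∈ N, (B, D) ∈ E ∧ ¬ D ⊆ A' ∪ B' ∧
      Relation.ReflTransGen (fun C D => (C, D) ∈ E ∧ C ≠ B ∧ D ≠ B) A D)
    (N' : Finset (Finset α)) (hN' : 3 ≤ N'.card)
    (hNE' : ∀ D ∈ N', (B', D) ∈ E' ∧ ¬ D ⊆ A ∪ B ∧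
      Relation.ReflTransGen (fun C D => (C, D) ∈ E' ∧ C ≠ B' ∧ D ≠ B') A' D) : False := by
  have hT := (mem_linkFamily.1 (hE.mem hAB)).1
  have hW := (mem_linkFamily.1 (hE'.mem hAB')).1
  have h1 : ∀ w ∈ A' ∪ B', w ≠ x → w ∈ A ∪ B := fun w hw hwx =>
    hE.mem_union_of_mem hG hAB hW hy (Finset.mem_union_left _ hy') hz
      (Finset.mem_union_right _ hz') N hN hNE hw hwx
  have h2 : ∀ w ∈ A ∪ B, w ≠ x' → w ∈ A' ∪ B' := fun w hw hwx =>
    hE'.mem_union_of_mem hG hAB' hT hy' (Finset.mem_union_left _ hy) hz'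
      (Finset.mem_union_right _ hz) N' hN' hNE' hw hwx
  by_cases hx' : x' ∈ A ∪ B
  · rcases Finset.mem_union.1 hx' with h | h
    · refine hE.false_of_shared_of_mem hE' hG hxx (hE.symm hAB) (hE'.symm hAB') hz hz' hy hy'
        ?_ ?_ h
      · simpa only [Finset.union_comm] using h1
      · simpa only [Finset.union_comm] using h2
    · exact hE.false_of_shared_of_mem hE' hG hxx hAB hAB' hy hy' hz hz' h1 h2 h
  · exact hE.false_of_shared_of_notMem hE' hG hxx hAB hAB' hy hy' hz hz' h1 hx'

end EdgeSystem

/-! ### The split graph of a `5`-region-free family. -/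

/-- A graph whose vertices form a laminar family and in which the intersection of two crossing
unions of edges is an end of each. -/
structure SplitGraph {α : Type*} [DecidableEq α] (E : Finset (Finset α × Finset α)) : Prop where
  disjoint : ∀ {A B}, (A, B) ∈ E → Disjoint A B
  nonempty : ∀ {A B}, (A, B) ∈ E → A.Nonempty
  symm : ∀ {A B}, (A, B) ∈ E → (B, A) ∈ E
  laminar : ∀ {A B C D}, (A, B) ∈ E → (C, D) ∈ E → ¬ Crosses A C
  cross : ∀ {A B C D}, (A, B) ∈ E → (C, D) ∈ E → Crosses (A ∪ B) (C ∪ D) →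
    (A ∪ B) ∩ (C ∪ D) = A ∨ (A ∪ B) ∩ (C ∪ D) = B

theorem SplitGraph.mono {α : Type*} [DecidableEq α] {E E' : Finset (Finset α × Finset α)}
    (h : SplitGraph E) (hE : E' ⊆ E) (hs : ∀ {A B}, (A, B) ∈ E' → (B, A) ∈ E') : SplitGraph E' where
  disjoint h1 := h.disjoint (hE h1)
  nonempty h1 := h.nonempty (hE h1)
  symm := hs
  laminar h1 h2 := h.laminar (hE h1) (hE h2)
  cross h1 h2 := h.cross (hE h1) (hE h2)

theorem three_le_card_of_independent (S : Finset (Bool × Bool))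
    (h1 : ∃ c ∈ S, c.1 = true) (h2 : ∃ c ∈ S, c.1 = false) (h3 : ∃ c ∈ S, c.2 = true)
    (h4 : ∃ c ∈ S, c.2 = false) (h5 : ∃ c ∈ S, c.1 = c.2) (h6 : ∃ c ∈ S, c.1 ≠ c.2) :
    3 ≤ S.card := by
  revert S; decide

theorem two_le_card_of_ne (S : Finset (Bool × Bool))
    (h1 : ∃ c ∈ S, c.1 = true) (h3 : ∃ c ∈ S, c.2 = true) (h6 : ∃ c ∈ S, c.1 ≠ c.2) :
    2 ≤ S.card := by
  revert S; decide

/-- In a `5`-region-free family, two sets crossing `T` and differing outside of `T` induce the same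
partition of `T`. -/
theorem RegionFree.inter_eq_or_of_sdiff_ne {α : Type*} [DecidableEq α] {H : Finset (Finset α)}
    (hH : RegionFree 5 H) {T Z Z' : Finset α} (hT : T ∈ H) (hZ : Z ∈ H) (hZ' : Z' ∈ H)
    (h : Crosses T Z) (h' : Crosses T Z') (hne : Z \ T ≠ Z' \ T) :
    T ∩ Z = T ∩ Z' ∨ T ∩ Z = T \ Z' := by
  by_contra! hcon
  obtain ⟨hc1, hc2⟩ := hcon
  have hext : ∀ {X Y : Finset α}, X ≠ Y → ∃ p, ¬ (p ∈ X ↔ p ∈ Y) := by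
    intro X Y hXY
    by_contra! hc
    exact hXY (Finset.ext hc)
  obtain ⟨⟨p1, hp1⟩, ⟨p2, hp2⟩, ⟨p3, hp3⟩⟩ := h
  obtain ⟨⟨q1, hq1⟩, ⟨q2, hq2⟩, ⟨q3, hq3⟩⟩ := h'
  obtain ⟨r1, hr1⟩ := hext hc1
  obtain ⟨r2, hr2⟩ := hext hc2
  obtain ⟨r3, hr3⟩ := hext hne
  simp only [Finset.mem_inter, Finset.mem_sdiff] at hp1 hp2 hp3 hq1 hq2 hq3 hr1 hr2 hr3
  have hr1T : r1 ∈ T := by by_contra h; simp [h] at hr1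
  have hr2T : r2 ∈ T := by by_contra h; simp [h] at hr2
  have hr3T : r3 ∉ T := by intro h; simp [h] at hr3
  simp only [hr1T, hr2T, hr3T, true_and, not_false_eq_true, and_true] at hr1 hr2 hr3
  let f : α → Bool × Bool := fun p => (decide (p ∈ Z), decide (p ∈ Z'))
  have hf : ∀ {S : Finset α} (p : α), p ∈ S → f p ∈ S.image f :=
    fun p hp => Finset.mem_image_of_mem f hp
  -- Two different partitions cut `T` into at least three cells. Two distinct non-empty remainders
  -- give at least two more outside `T`, five regions in all.
  have h3 : 3 ≤ (T.image f).card := by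
    refine three_le_card_of_independent _ ⟨_, hf p1 hp1.1, ?_⟩ ⟨_, hf p2 hp2.1, ?_⟩
      ⟨_, hf q1 hq1.1, ?_⟩ ⟨_, hf q2 hq2.1, ?_⟩ ⟨_, hf r2 hr2T, ?_⟩ ⟨_, hf r1 hr1T, ?_⟩
    · simp [f, hp1.2]
    · simp [f, hp2.2]
    · simp [f, hq1.2]
    · simp [f, hq2.2]
    · simpa only [f, decide_eq_decide, not_iff, not_iff_not] using hr2
    · simpa only [f, ne_eq, decide_eq_decide] using hr1
  have h2 : 2 ≤ (((Z ∪ Z') \ T).image f).card := by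
    refine two_le_card_of_ne _ ⟨_, hf p3 ?_, ?_⟩ ⟨_, hf q3 ?_, ?_⟩ ⟨_, hf r3 ?_, ?_⟩
    · simp [hp3]
    · simp [f, hp3.1]
    · simp [hq3]
    · simp [f, hq3.1]
    · rw [Finset.mem_sdiff, Finset.mem_union]
      refine ⟨?_, hr3T⟩
      by_contra! h
      simp [h] at hr3
    · simpa only [f, ne_eq, decide_eq_decide] using hr3
  have hsub : (T.image f).image (Prod.mk true) ∪ (((Z ∪ Z') \ T).image f).image (Prod.mk false) ⊆
      innerRegions T Z Z' := by
    intro c hc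
    simp only [Finset.mem_union, Finset.mem_image, Finset.mem_sdiff] at hc
    rcases hc with ⟨_, ⟨p, hp, rfl⟩, rfl⟩ | ⟨_, ⟨p, hp, rfl⟩, rfl⟩
    · exact mem_innerRegions_of p (by simp) (by simp [hp]) (by simp) (by simp)
    · exact mem_innerRegions_of p (by simpa using hp.1) (by simp [hp.2]) (by simp) (by simp)
  have h5 := Finset.card_le_card hsub
  rw [Finset.card_union_of_disjoint, Finset.card_image_of_injective _ (Prod.mk_right_injective _),
    Finset.card_image_of_injective _ (Prod.mk_right_injective _)] at h5
  · have := hH T hT Z hZ Z' hZ'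
    omega
  · rw [Finset.disjoint_left]
    intro c hc hc'
    simp only [Finset.mem_image] at hc hc'
    obtain ⟨_, -, rfl⟩ := hc
    obtain ⟨_, -, h⟩ := hc'
    simp at h

/-- `T` is crossed by two members of `H` that differ outside of `T`. -/
def IsSplitMember {α : Type*} [DecidableEq α] (H : Finset (Finset α)) (T : Finset α) : Prop :=
  ∃ Z ∈ H, ∃ Z' ∈ H, Crosses T Z ∧ Crosses T Z' ∧ Z \ T ≠ Z' \ T

/-- If `Z` and `Z'` agree outside `T`, one of the two witnesses of `IsSplitMember` differs from them
there, and both are compared with it. -/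
theorem RegionFree.inter_eq_or {α : Type*} [DecidableEq α] {H : Finset (Finset α)}
    (hH : RegionFree 5 H) {T Z Z' : Finset α} (hT : T ∈ H) (hQ : IsSplitMember H T) (hZ : Z ∈ H)
    (hZ' : Z' ∈ H) (h : Crosses T Z) (h' : Crosses T Z') :
    T ∩ Z = T ∩ Z' ∨ T ∩ Z = T \ Z' := by
  by_cases hne : Z \ T = Z' \ T
  · obtain ⟨Y, hY, hTY, hYZ⟩ : ∃ Y ∈ H, Crosses T Y ∧ Y \ T ≠ Z \ T := by
      obtain ⟨Y, hY, Y', hY', hTY, hTY', hYY⟩ := hQ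
      by_cases h1 : Y \ T = Z \ T
      · exact ⟨Y', hY', hTY', fun h2 => hYY (h1.trans h2.symm)⟩
      · exact ⟨Y, hY, hTY, h1⟩
    have e1 := hH.inter_eq_or_of_sdiff_ne hT hY hZ hTY h hYZ
    have e2 := hH.inter_eq_or_of_sdiff_ne hT hY hZ' hTY h' (hne ▸ hYZ)
    rcases e1 with e1 | e1 <;> rcases e2 with e2 | e2
    · exact .inl (e1.symm.trans e2)
    · exact .inr (e1.symm.trans e2)
    · right
      have e3 := e1.symm.trans e2
      ext p
      have := Finset.ext_iff.1 e3 p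
      simp only [Finset.mem_inter, Finset.mem_sdiff] at this ⊢
      tauto
    · left
      have e3 := e1.symm.trans e2
      ext p
      have := Finset.ext_iff.1 e3 p
      simp only [Finset.mem_inter, Finset.mem_sdiff] at this ⊢
      tauto
  · exact hH.inter_eq_or_of_sdiff_ne hT hZ hZ' h h' hne

/-- The partition `{A, B}` of `A ∪ B` is induced by a member of `H` crossing `A ∪ B`. -/
def IsSplit {α : Type*} [DecidableEq α] (H : Finset (Finset α)) (A B : Finset α) : Prop :=
  A ∪ B ∈ H ∧ IsSplitMember H (A ∪ B) ∧ A.Nonempty ∧ B.Nonempty ∧ Disjoint A B ∧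
    ∃ Z ∈ H, Crosses (A ∪ B) Z ∧ ((A ∪ B) ∩ Z = A ∨ (A ∪ B) ∩ Z = B)

theorem IsSplit.symm {α : Type*} [DecidableEq α] {H : Finset (Finset α)} {A B : Finset α}
    (h : IsSplit H A B) : IsSplit H B A := by
  obtain ⟨h1, h2, h3, h4, h5, Z, h6, h7, h8⟩ := h
  rw [Finset.union_comm] at h1 h2 h7 h8
  exact ⟨h1, h2, h4, h3, h5.symm, Z, h6, h7, h8.symm⟩

theorem IsSplit.inter_eq_or {α : Type*} [DecidableEq α] {H : Finset (Finset α)} {A B Z : Finset α}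
    (hH : RegionFree 5 H) (h : IsSplit H A B) (hZ : Z ∈ H) (hc : Crosses (A ∪ B) Z) :
    (A ∪ B) ∩ Z = A ∨ (A ∪ B) ∩ Z = B := by
  obtain ⟨h1, h2, h3, h4, h5, Z', h6, h7, h8⟩ := h
  have hA : (A ∪ B) \ A = B := by
    rw [Finset.union_sdiff_left]; exact Finset.sdiff_eq_self_of_disjoint h5.symm
  have hB : (A ∪ B) \ B = A := by
    rw [Finset.union_sdiff_right]; exact Finset.sdiff_eq_self_of_disjoint h5
  rcases hH.inter_eq_or h1 h2 hZ h6 hc h7 with e | e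
  · rw [e]; exact h8
  · rw [e, ← Finset.sdiff_inter_self_left]
    rcases h8 with e | e <;> rw [e]
    · exact .inr hA
    · exact .inl hB

/-- Take `p ∈ A ∩ C` and `q ∈ A \ C`, so `q ∈ D`. A member inducing `{C, D}` separates `p` from `q`
and sticks out of `C ∪ D`. So it crosses `A ∪ B` and must induce `{A, B}`, although `p` and `q` both
lie in `A`. -/
theorem IsSplit.not_crosses_of_subset {α : Type*} [DecidableEq α] {H : Finset (Finset α)}
    (hH : RegionFree 5 H) {A B C D : Finset α} (h : IsSplit H A B) (h' : IsSplit H C D)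
    (hs : A ∪ B ⊆ C ∪ D) : ¬ Crosses A C := by
  rintro ⟨⟨p, hp⟩, ⟨q, hq⟩, -⟩
  obtain ⟨-, -, -, -, h5, W, hW, ⟨-, -, ⟨w, hw⟩⟩, hCW⟩ := h'
  have hAB := Finset.disjoint_left.1 h.2.2.2.2.1
  have hCD := Finset.disjoint_left.1 h5
  simp only [Finset.mem_inter, Finset.mem_sdiff] at hp hq hw
  have hpT : p ∈ A ∪ B := Finset.mem_union_left _ hp.1
  have hqT : q ∈ A ∪ B := Finset.mem_union_left _ hq.1
  have hpU := hs hpT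
  have hqU := hs hqT
  have hqD : q ∈ D := (Finset.mem_union.1 hqU).resolve_left hq.2
  have hpq : ¬ (p ∈ W ↔ q ∈ W) := by
    rcases hCW with e | e
    · have e1 := Finset.ext_iff.1 e p
      have e2 := Finset.ext_iff.1 e q
      simp only [Finset.mem_inter, hpU, hqU, true_and] at e1 e2
      rw [e1, e2]; tauto
    · have e1 := Finset.ext_iff.1 e p
      have e2 := Finset.ext_iff.1 e q
      simp only [Finset.mem_inter, hpU, hqU, true_and] at e1 e2
      rw [e1, e2]
      have := hCD hp.2
      tauto
  have hc : Crosses (A ∪ B) W := by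
    refine ⟨?_, ?_, w, by simp only [Finset.mem_sdiff]; exact ⟨hw.1, fun h => hw.2 (hs h)⟩⟩
    · by_cases hpW : p ∈ W
      · exact ⟨p, Finset.mem_inter.2 ⟨hpT, hpW⟩⟩
      · exact ⟨q, Finset.mem_inter.2 ⟨hqT, by tauto⟩⟩
    · by_cases hpW : p ∈ W
      · exact ⟨q, Finset.mem_sdiff.2 ⟨hqT, by tauto⟩⟩
      · exact ⟨p, Finset.mem_sdiff.2 ⟨hpT, hpW⟩⟩
  have hpB := hAB hp.1
  have hqB := hAB hq.1
  rcases h.inter_eq_or hH hW hc with e | e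
  all_goals
    have e1 := Finset.ext_iff.1 e p
    have e2 := Finset.ext_iff.1 e q
    simp only [Finset.mem_inter, hpT, hqT, true_and] at e1 e2
    tauto

/-- If neither union contains the other, they cross, and their intersection is an end of both edges.
Containing a point of `A ∩ C`, it equals both `A` and `C`. -/
theorem IsSplit.not_crosses {α : Type*} [DecidableEq α] {H : Finset (Finset α)}
    (hH : RegionFree 5 H) {A B C D : Finset α} (h : IsSplit H A B) (h' : IsSplit H C D) :
    ¬ Crosses A C := by
  intro hAC
  obtain ⟨⟨p, hp⟩, ⟨q, hq⟩, -⟩ := id hAC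
  simp only [Finset.mem_inter, Finset.mem_sdiff] at hp hq
  by_cases hs : A ∪ B ⊆ C ∪ D
  · exact h.not_crosses_of_subset hH h' hs hAC
  by_cases hs' : C ∪ D ⊆ A ∪ B
  · exact h'.not_crosses_of_subset hH h hs' hAC.symm
  have hc : Crosses (A ∪ B) (C ∪ D) :=
    ⟨⟨p, by simp [hp]⟩, Finset.sdiff_nonempty.2 hs, Finset.sdiff_nonempty.2 hs'⟩
  have hpm : p ∈ (A ∪ B) ∩ (C ∪ D) := by simp [hp]
  have e1 := h.inter_eq_or hH h'.1 hc
  have e2 := h'.inter_eq_or hH h.1 hc.symm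
  rw [Finset.inter_comm] at e2
  have e1' := e1.resolve_right fun e =>
    Finset.disjoint_left.1 h.2.2.2.2.1 hp.1 (e ▸ hpm)
  have e2' := e2.resolve_right fun e =>
    Finset.disjoint_left.1 h'.2.2.2.2.1 hp.2 (e ▸ hpm)
  exact hq.2 ((e1'.symm.trans e2') ▸ hq.1)

/-- A `5`-region-free family is, up to linearly many members, encoded by a graph of splits. -/
theorem RegionFree.exists_splitGraph {α : Type*} [DecidableEq α] {H : Finset (Finset α)}
    (hH : RegionFree 5 H) {V : Finset α} (hV : ∀ T ∈ H, T ⊆ V) :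
    ∃ E : Finset (Finset α × Finset α), SplitGraph E ∧ (∀ e ∈ E, e.1 ∪ e.2 ∈ H) ∧
      H.card ≤ 4 * V.card + 1 + E.card ∧ (E.image Prod.fst).card ≤ 4 * V.card + 1 := by
  classical
  let E : Finset (Finset α × Finset α) :=
    (V.powerset ×ˢ V.powerset).filter fun e => IsSplit H e.1 e.2
  have hE : ∀ {A B}, (A, B) ∈ E ↔ IsSplit H A B := by
    intro A B
    simp only [E, Finset.mem_filter, Finset.mem_product, Finset.mem_powerset, and_iff_right_iff_imp]
    exact fun h => Finset.union_subset_iff.1 (hV _ h.1)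
  have hsg : SplitGraph E :=
    { disjoint := fun h => (hE.1 h).2.2.2.2.1
      nonempty := fun h => (hE.1 h).2.2.1
      symm := fun h => hE.2 (hE.1 h).symm
      laminar := fun h h' => (hE.1 h).not_crosses hH (hE.1 h')
      cross := fun h h' hc => (hE.1 h).inter_eq_or hH (hE.1 h').1 hc }
  refine ⟨E, hsg, fun e he => (hE.1 he).1, ?_, ?_⟩
  · rw [← Finset.card_filter_add_card_filter_not (s := H) (IsSplitMember H), add_comm]
    refine add_le_add ?_ ?_
    · refine card_le_of_crosses_sdiff_eq V _ (fun T hT => hV T (Finset.mem_filter.1 hT).1) ?_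
      intro T hT Z hZ Z' hZ' h h'
      rw [Finset.mem_filter] at hT hZ hZ'
      by_contra hne
      exact hT.2 ⟨Z, hZ.1, Z', hZ'.1, h, h', hne⟩
    · refine (Finset.card_le_card (t := E.image fun e => e.1 ∪ e.2) ?_).trans Finset.card_image_le
      intro T hT
      obtain ⟨hT, hQ⟩ := Finset.mem_filter.1 hT
      obtain ⟨Z, hZ, -, -, hc, -⟩ := id hQ
      have hu : T ∩ Z ∪ T \ Z = T := by rw [Finset.union_comm]; exact Finset.sdiff_union_inter T Z
      refine Finset.mem_image.2 ⟨(T ∩ Z, T \ Z), hE.2 ?_, hu⟩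
      refine ⟨by rwa [hu], by rwa [hu], hc.1, hc.2.1, ?_, Z, hZ, by rwa [hu], .inl (by rw [hu])⟩
      exact (Finset.disjoint_sdiff_inter T Z).symm
  -- The vertices never cross, so the condition on crossing sets is vacuous.
  · refine card_le_of_crosses_sdiff_eq V _ ?_ ?_
    · intro A hA
      obtain ⟨⟨A, B⟩, h, rfl⟩ := Finset.mem_image.1 hA
      exact Finset.subset_union_left.trans (hV _ (hE.1 h).1)
    · intro T hT Z hZ Z' hZ' h h'
      obtain ⟨⟨A, B⟩, hA, rfl⟩ := Finset.mem_image.1 hT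
      obtain ⟨⟨C, D⟩, hC, rfl⟩ := Finset.mem_image.1 hZ
      exact absurd h (hsg.laminar hA hC)

/-! ### Pruning, and disjointness within components. -/

/-- Deleting vertices of small degree from a graph. -/
theorem exists_subgraph_degree_ge {β : Type*} [DecidableEq β] (K : ℕ) (S : Finset β) :
    ∀ E : Finset (β × β), (∀ e ∈ E, e.1 ∈ S) → (∀ {a b}, (a, b) ∈ E → (b, a) ∈ E) →
      ∃ E' ⊆ E, (∀ {a b}, (a, b) ∈ E' → (b, a) ∈ E') ∧
        (∀ {a b}, (a, b) ∈ E' → K ≤ (E'.filter fun e => e.1 = a).card) ∧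
        E.card ≤ E'.card + 2 * K * S.card := by
  induction S using Finset.strongInduction with
  | H S ih =>
    intro E hS hsymm
    by_cases hdeg : ∀ {a b}, (a, b) ∈ E → K ≤ (E.filter fun e => e.1 = a).card
    · exact ⟨E, subset_rfl, hsymm, hdeg, by omega⟩
    push Not at hdeg
    obtain ⟨a, b, hab, hlt⟩ := hdeg
    have haS : a ∈ S := hS _ hab
    obtain ⟨E', hE', h1, h2, h3⟩ := ih (S.erase a) (Finset.erase_ssubset haS)
      (E.filter fun e => e.1 ≠ a ∧ e.2 ≠ a) (by
        intro e he
        rw [Finset.mem_filter] at he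
        exact Finset.mem_erase.2 ⟨he.2.1, hS e he.1⟩) (by
        intro c d hcd
        rw [Finset.mem_filter] at hcd ⊢
        exact ⟨hsymm hcd.1, hcd.2.2, hcd.2.1⟩)
    refine ⟨E', hE'.trans (Finset.filter_subset _ _), h1, h2, ?_⟩
    -- Each edge at `a` is stored as two ordered pairs, hence the factor 2 in the loss.
    have h4 : E.card ≤ (E.filter fun e => e.1 ≠ a ∧ e.2 ≠ a).card +
        ((E.filter fun e => e.1 = a).card + (E.filter fun e => e.2 = a).card) := by
      refine (Finset.card_le_card ?_).trans
        ((Finset.card_union_le _ _).trans (Nat.add_le_add_left (Finset.card_union_le _ _) _))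
      intro e he
      simp only [Finset.mem_union, Finset.mem_filter]
      tauto
    have h5 : (E.filter fun e => e.2 = a).card ≤ (E.filter fun e => e.1 = a).card := by
      refine Finset.card_le_card_of_injOn Prod.swap ?_ Prod.swap_injective.injOn
      rintro ⟨c, d⟩ he
      simp only [Finset.coe_filter, Set.mem_ofPred_eq, Prod.swap_prod_mk] at he ⊢
      exact ⟨hsymm he.1, he.2⟩
    rw [Finset.card_erase_of_mem haS] at h3
    have hpos : 0 < S.card := Finset.card_pos.2 ⟨a, haS⟩
    obtain ⟨s, hs⟩ : ∃ s, S.card = s + 1 := ⟨S.card - 1, by omega⟩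
    rw [hs] at h3 ⊢
    simp only [Nat.add_sub_cancel] at h3
    nlinarith

theorem exists_rel_of_reflTransGen {β : Type*} {r : β → β → Prop} {a b : β}
    (hr : Relation.ReflTransGen r a b) (hne : a ≠ b) : (∃ c, r a c) ∧ ∃ d, r d b := by
  constructor
  · obtain h | ⟨c, h, -⟩ := hr.cases_head
    · exact absurd h hne
    · exact ⟨c, h⟩
  · obtain h | ⟨c, -, h⟩ := hr.cases_tail
    · exact absurd h.symm hne
    · exact ⟨c, h⟩

namespace SplitGraph

variable {α : Type*} [DecidableEq α] {E : Finset (Finset α × Finset α)}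

theorem disjoint_or_subset (hE : SplitGraph E) {A B C D : Finset α} (h : (A, B) ∈ E)
    (h' : (C, D) ∈ E) : Disjoint A C ∨ A ⊆ C ∨ C ⊆ A := by
  by_contra! hc
  exact hE.laminar h h' ⟨Finset.not_disjoint_iff_nonempty_inter.1 hc.1,
    Finset.sdiff_nonempty.2 hc.2.1, Finset.sdiff_nonempty.2 hc.2.2⟩

/-- If `D` were disjoint from `A` or properly inside it, `C ∪ D` and `A ∪ B` would cross in `B` or
`B ∪ D`, which is neither `C` nor `D`. -/
theorem ssubset_of_nested (hE : SplitGraph E) {A B C D : Finset α} (hAB : (A, B) ∈ E)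
    (hAC : (A, C) ∈ E) (hBC : B ⊂ C) (hCD : (C, D) ∈ E) (hDA : D ≠ A) : A ⊂ D := by
  have dAC := Finset.disjoint_left.1 (hE.disjoint hAC)
  have dAB := Finset.disjoint_left.1 (hE.disjoint hAB)
  have dCD := Finset.disjoint_left.1 (hE.disjoint hCD)
  obtain ⟨a, ha⟩ := hE.nonempty hAB
  obtain ⟨b, hb⟩ := hE.nonempty (hE.symm hAB)
  obtain ⟨d, hd⟩ := hE.nonempty (hE.symm hCD)
  obtain ⟨c, hc, hcB⟩ := Finset.not_subset.1 hBC.2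
  have hbC := hBC.1 hb
  rcases hE.disjoint_or_subset (hE.symm hCD) hAB with h | h | h
  · exfalso
    have h := Finset.disjoint_left.1 h
    have hdB : d ∉ B := fun h => dCD (hBC.1 h) hd
    have := hE.cross hCD hAB ⟨⟨b, by simp [hb, hbC]⟩,
      ⟨d, by simp [hd, hdB, h hd]⟩, ⟨a, by simp [ha, dAC ha, show a ∉ D from fun h' => h h' ha]⟩⟩
    rcases this with e | e
    · have := Finset.ext_iff.1 e c
      simp [hc, hcB, show c ∉ A from fun h => dAC h hc] at this
    · have := Finset.ext_iff.1 e b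
      simp [hb, hbC, dCD hbC] at this
  · exfalso
    obtain ⟨a', ha', ha'D⟩ := Finset.not_subset.1 fun h' : A ⊆ D => hDA (h.antisymm h')
    have hcA : c ∉ A := fun h => dAC h hc
    have := hE.cross hCD hAB ⟨⟨b, by simp [hb, hbC]⟩,
      ⟨c, by simp [hc, hcB, hcA]⟩, ⟨a', by simp [ha', dAC ha', ha'D]⟩⟩
    rcases this with e | e
    · have := Finset.ext_iff.1 e c
      simp [hc, hcB, hcA] at this
    · have := Finset.ext_iff.1 e b
      simp [hb, hbC, dCD hbC] at this
  · exact lt_of_le_of_ne h (Ne.symm hDA)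

/-- Adjacent vertices all have at least three neighbours. -/
def HasDegrees (E : Finset (Finset α × Finset α)) : Prop :=
  ∀ {A B}, (A, B) ∈ E → 3 ≤ (E.filter fun e => e.1 = A).card

theorem exists_nbr_ne (hd : HasDegrees E) {A B : Finset α} (h : (A, B) ∈ E) (C D : Finset α) :
    ∃ F, (A, F) ∈ E ∧ F ≠ C ∧ F ≠ D := by
  by_contra! hcon
  have h3 := hd h
  have : (E.filter fun e => e.1 = A) ⊆ {(A, C), (A, D)} := by
    rintro ⟨A', F⟩ he
    rw [Finset.mem_filter] at he
    obtain ⟨he, rfl⟩ := he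
    simp only [Finset.mem_insert, Finset.mem_singleton, Prod.mk.injEq, true_and]
    by_cases hF : F = C
    · exact .inl hF
    · exact .inr (hcon F he hF)
  have := (Finset.card_le_card this).trans Finset.card_le_two
  omega

/-- A nested pair propagates: two further neighbours `D`, `D'` of `C` contain `A`, so they are
nested, say `D ⊂ D'`. Then a further neighbour `F` of `D` contains `C`, and `C ∪ D'` crosses `D ∪ F`
in `C ∪ D`, not an end of the first edge. -/
theorem not_ssubset_nbrs (hE : SplitGraph E) (hd : HasDegrees E) {A B C : Finset α}
    (hAB : (A, B) ∈ E) (hAC : (A, C) ∈ E) : ¬ B ⊂ C := by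
  intro hBC
  have key : ∀ {D D' : Finset α}, (C, D) ∈ E → (C, D') ∈ E → D ≠ A → D ⊂ D' → False := by
    intro D D' hCD hCD' hDA hDD
    have hAD := hE.ssubset_of_nested hAB hAC hBC hCD hDA
    obtain ⟨F, hDF, hFC, -⟩ := exists_nbr_ne hd (hE.symm hCD) C C
    have hCF := hE.ssubset_of_nested (hE.symm hAC) hCD hAD hDF hFC
    have dDF := Finset.disjoint_left.1 (hE.disjoint hDF)
    have dCD' := Finset.disjoint_left.1 (hE.disjoint hCD')
    have dCD := Finset.disjoint_left.1 (hE.disjoint hCD)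
    obtain ⟨p, hp⟩ := hE.nonempty hCD
    obtain ⟨q, hq⟩ := hE.nonempty hDF
    obtain ⟨r, hr, hrC⟩ := Finset.not_subset.1 hCF.2
    obtain ⟨s, hs, hsD⟩ := Finset.not_subset.1 hDD.2
    have hFD' : ∀ {t}, t ∈ F → t ∉ D' := by
      rcases hE.disjoint_or_subset (hE.symm hDF) (hE.symm hCD') with h | h | h
      · exact fun ht => Finset.disjoint_left.1 h ht
      · exact absurd (h (hCF.1 hp)) (dCD' hp)
      · exact absurd (h (hDD.1 hq)) (dDF hq)
    have := hE.cross hCD' hDF ⟨⟨p, by simp [hp, hCF.1 hp]⟩,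
      ⟨s, by simp [hs, hsD, show s ∉ F from fun h => hFD' h hs]⟩, ⟨r, by simp [hr, hrC, hFD' hr]⟩⟩
    rcases this with e | e
    · have := Finset.ext_iff.1 e q
      simp [hq, hDD.1 hq, show q ∉ C from fun h => dCD h hq] at this
    · have := Finset.ext_iff.1 e p
      simp [hp, hCF.1 hp, dCD' hp] at this
  obtain ⟨D, hCD, hDA, -⟩ := exists_nbr_ne hd (hE.symm hAC) A A
  obtain ⟨D', hCD', hDA', hDD⟩ := exists_nbr_ne hd (hE.symm hAC) A D
  have h1 := hE.ssubset_of_nested hAB hAC hBC hCD hDA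
  have h2 := hE.ssubset_of_nested hAB hAC hBC hCD' hDA'
  obtain ⟨a, ha⟩ := hE.nonempty hAB
  rcases hE.disjoint_or_subset (hE.symm hCD) (hE.symm hCD') with h | h | h
  · exact Finset.disjoint_left.1 h (h1.1 ha) (h2.1 ha)
  · exact key hCD hCD' hDA (lt_of_le_of_ne h hDD.symm)
  · exact key hCD' hCD hDA' (lt_of_le_of_ne h hDD)

theorem disjoint_nbrs (hE : SplitGraph E) (hd : HasDegrees E) {A B C : Finset α}
    (hAB : (A, B) ∈ E) (hAC : (A, C) ∈ E) (hne : B ≠ C) : Disjoint B C := by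
  rcases hE.disjoint_or_subset (hE.symm hAB) (hE.symm hAC) with h | h | h
  · exact h
  · exact absurd (lt_of_le_of_ne h hne) (hE.not_ssubset_nbrs hd hAB hAC)
  · exact absurd (lt_of_le_of_ne h hne.symm) (hE.not_ssubset_nbrs hd hAC hAB)

/-- Otherwise `B` is disjoint from `A'`. The crossing condition then forces `B` into every neighbour
of `A'`, but these are pairwise disjoint. -/
theorem nbr_ssubset (hE : SplitGraph E) (hd : HasDegrees E) {A B A' B' : Finset α}
    (hAB : (A, B) ∈ E) (hAB' : (A', B') ∈ E) (hs : A ⊂ A') : B ⊂ A' := by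
  have dAB := Finset.disjoint_left.1 (hE.disjoint hAB)
  obtain ⟨a, ha⟩ := hE.nonempty hAB
  obtain ⟨b, hb⟩ := hE.nonempty (hE.symm hAB)
  obtain ⟨a', ha', haA⟩ := Finset.not_subset.1 hs.2
  rcases hE.disjoint_or_subset (hE.symm hAB) hAB' with h | h | h
  · exfalso
    have hBA' := Finset.disjoint_left.1 h
    have key : ∀ {C}, (A', C) ∈ E → B ⊆ C := by
      intro C hC
      have dC := Finset.disjoint_left.1 (hE.disjoint hC)
      obtain ⟨c, hc⟩ := hE.nonempty (hE.symm hC)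
      by_contra hBC
      obtain ⟨b', hb', hbC⟩ := Finset.not_subset.1 hBC
      have := hE.cross hC hAB ⟨⟨a, by simp [ha, hs.1 ha]⟩,
        ⟨a', by simp [ha', haA, show a' ∉ B from fun h => hBA' h ha']⟩, ⟨b', by simp [hb', hbC, hBA' hb']⟩⟩
      rcases this with e | e
      · have := Finset.ext_iff.1 e a'
        simp [ha', haA, show a' ∉ B from fun h => hBA' h ha'] at this
      · have := Finset.ext_iff.1 e a
        simp [ha, hs.1 ha, dC (hs.1 ha)] at this
    obtain ⟨C, hC, hne, -⟩ := exists_nbr_ne hd hAB' B' B'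
    exact Finset.disjoint_left.1 (hE.disjoint_nbrs hd hC hAB' hne) (key hC hb) (key hAB' hb)
  · exact lt_of_le_of_ne h fun e => dAB ha (e ▸ hs.1 ha)
  · exact absurd (h (hs.1 ha)) (dAB ha)

theorem reach_ssubset (hE : SplitGraph E) (hd : HasDegrees E) {A B A' B' : Finset α}
    (hr : Relation.ReflTransGen (fun C D => (C, D) ∈ E) A B) (hAB' : (A', B') ∈ E)
    (hs : A ⊂ A') : B ⊂ A' := by
  induction hr with
  | refl => exact hs
  | tail _ h ih => exact hE.nbr_ssubset hd h hAB' ih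

theorem reach_symm (hE : SplitGraph E) {A B : Finset α}
    (h : Relation.ReflTransGen (fun C D => (C, D) ∈ E) A B) :
    Relation.ReflTransGen (fun C D => (C, D) ∈ E) B A := by
  induction h with
  | refl => exact .refl
  | tail _ h ih => exact .head (hE.symm h) ih

/-- Proper containment spreads along paths, so a vertex reachable from a proper subset of itself
would be properly contained in itself. -/
theorem eq_or_disjoint_of_reach (hE : SplitGraph E) (hd : HasDegrees E) {A B : Finset α}
    (hr : Relation.ReflTransGen (fun C D => (C, D) ∈ E) A B) : A = B ∨ Disjoint A B := by
  by_cases hne : A = B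
  · exact .inl hne
  right
  obtain ⟨⟨C, hC⟩, D, hD⟩ := exists_rel_of_reflTransGen hr hne
  rcases hE.disjoint_or_subset hC (hE.symm hD) with h | h | h
  · exact h
  · exact absurd (hE.reach_ssubset hd hr (hE.symm hD) (lt_of_le_of_ne h hne)) (fun h => h.2 h.1)
  · exact absurd (hE.reach_ssubset hd (hE.reach_symm hr) hC (lt_of_le_of_ne h (Ne.symm hne)))
      (fun h => h.2 h.1)

/-- An edge is determined by a point in each of its ends. -/
theorem eq_of_mem (hE : SplitGraph E) (hd : HasDegrees E) {A B A' B' : Finset α}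
    (hAB : (A, B) ∈ E) (hAB' : (A', B') ∈ E) {y z : α} (hy : y ∈ A) (hy' : y ∈ A') (hz : z ∈ B)
    (hz' : z ∈ B') : A = A' ∧ B = B' := by
  have dAB := Finset.disjoint_left.1 (hE.disjoint hAB)
  have dAB' := Finset.disjoint_left.1 (hE.disjoint hAB')
  by_cases hA : A = A'
  · refine ⟨hA, ?_⟩
    subst hA
    by_contra hne
    exact Finset.disjoint_left.1 (hE.disjoint_nbrs hd hAB hAB' hne) hz hz'
  rcases hE.disjoint_or_subset hAB hAB' with h | h | h
  · exact absurd hy' (Finset.disjoint_left.1 h hy)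
  · exact absurd hz' (dAB' ((hE.nbr_ssubset hd hAB hAB' (lt_of_le_of_ne h hA)).1 hz))
  · exact absurd hz (dAB ((hE.nbr_ssubset hd hAB' hAB (lt_of_le_of_ne h (Ne.symm hA))).1 hz'))

theorem edgeSystem (hE : SplitGraph E) {G : Finset (Finset α)} {x : α}
    (hd : ∀ {A B}, (A, B) ∈ E → 6 ≤ (E.filter fun e => e.1 = A).card)
    (hm : ∀ e ∈ E, e.1 ∪ e.2 ∈ linkFamily G x) : EdgeSystem G x E where
  mem h := hm _ h
  nonempty := hE.nonempty
  symm := hE.symm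
  ne h e := by
    obtain ⟨a, ha⟩ := hE.nonempty h
    exact Finset.disjoint_left.1 (hE.disjoint h) ha (e ▸ ha)
  degree := hd
  component h := hE.eq_or_disjoint_of_reach (fun h => le_trans (by norm_num) (hd h)) h

end SplitGraph

/-! ### Good edges of a ranked graph. -/

/-- The edge from `a` up to `b` is good if `b` has three further neighbours of smaller rank than `a`
that are connected to `a` through vertices of smaller rank than `b`. -/
def IsGoodEdge {β : Type*} (E : Finset (β × β)) (ρ : β → ℕ) (a b : β) : Prop :=
  ρ a < ρ b ∧ ∃ N : Finset β, 3 ≤ N.card ∧ ∀ d ∈ N, (b, d) ∈ E ∧ ρ d < ρ a ∧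
    Relation.ReflTransGen (fun c d => (c, d) ∈ E ∧ ρ c < ρ b ∧ ρ d < ρ b) a d

open Classical in
/-- All but linearly many upward edges of a ranked graph are good. -/
theorem card_le_card_goodEdges {β : Type*} [DecidableEq β] (E : Finset (β × β)) (ρ : β → ℕ)
    (hsymm : ∀ {a b}, (a, b) ∈ E → (b, a) ∈ E) (hirr : ∀ {a b}, (a, b) ∈ E → a ≠ b)
    (hρ : ∀ {a b}, Relation.ReflTransGen (fun a b => (a, b) ∈ E) a b → ρ a = ρ b → a = b) :
    E.card ≤ 12 * (E.image Prod.fst).card +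
      2 * (E.filter fun e => IsGoodEdge E ρ e.1 e.2).card := by
  set up := E.filter fun e => ρ e.1 < ρ e.2 with hup
  set S := E.image Prod.fst with hS
  have hmem : ∀ {a b}, (a, b) ∈ up ↔ (a, b) ∈ E ∧ ρ a < ρ b := by simp [hup]
  -- half of the ordered edges go up
  have h2 : E.card ≤ 2 * up.card := by
    rw [← Finset.card_filter_add_card_filter_not (s := E) (fun e => ρ e.1 < ρ e.2), two_mul]
    refine Nat.add_le_add_left ?_ _
    refine Finset.card_le_card_of_injOn Prod.swap ?_ Prod.swap_injective.injOn
    rintro ⟨a, b⟩ he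
    simp only [Finset.coe_filter, Set.mem_ofPred_eq, not_lt] at he
    simp only [Prod.swap_prod_mk, Finset.mem_coe, hmem]
    exact ⟨hsymm he.1, lt_of_le_of_ne he.2 fun h => hirr (hsymm he.1) (hρ (.single (hsymm he.1)) h)⟩
  let R : β → β → β → Prop := fun b =>
    Relation.ReflTransGen fun c d => (c, d) ∈ E ∧ ρ c < ρ b ∧ ρ d < ρ b
  have Rsymm : ∀ {b a c}, R b a c → R b c a := by
    intro b a c h
    induction h with
    | refl => exact .refl
    | tail _ h ih => exact .head ⟨hsymm h.1, h.2.2, h.2.1⟩ ih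
  have Rmono : ∀ {b b' a c}, ρ b ≤ ρ b' → R b a c → R b' a c := fun hb h =>
    Relation.ReflTransGen.mono
      (fun _ _ h => ⟨h.1, lt_of_lt_of_le h.2.1 hb, lt_of_lt_of_le h.2.2 hb⟩) _ _ h
  have Rreach : ∀ {b a c}, R b a c → Relation.ReflTransGen (fun a b => (a, b) ∈ E) a c :=
    fun h => Relation.ReflTransGen.mono (fun _ _ h => h.1) _ _ h
  -- the vertex of minimal rank in the class of `a` below `b`
  have hm : ∀ a b, ∃ m, R b a m ∧ ∀ c, R b a c → ρ m ≤ ρ c := by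
    intro a b
    obtain ⟨m, hm, hmin⟩ := (measure ρ).wf.has_min {c | R b a c} ⟨a, .refl⟩
    exact ⟨m, hm, fun c hc => not_lt.1 (hmin c hc)⟩
  choose m hm hmin using hm
  have hn : ∀ b, ∃ n, ∀ a, (a, b) ∈ up → (∃ a', (a', b) ∈ up ∧ R b a' n) ∧
      ∀ a' c, (a', b) ∈ up → R b a' c → ρ n ≤ ρ c := by
    intro b
    by_cases h : ∃ a, (a, b) ∈ up
    · obtain ⟨a, ha⟩ := h
      obtain ⟨n, hn, hmin⟩ := (measure ρ).wf.has_min {c | ∃ a', (a', b) ∈ up ∧ R b a' c}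
        ⟨a, a, ha, .refl⟩
      exact ⟨n, fun _ _ => ⟨hn, fun a' c h h' => not_lt.1 (hmin c ⟨a', h, h'⟩)⟩⟩
    · exact ⟨b, fun a ha => absurd ⟨a, ha⟩ h⟩
  choose n hn using hn
  set bad := up.filter fun e => ¬ IsGoodEdge E ρ e.1 e.2 with hbad
  -- Among the classes seen from `b`, the one with the overall lowest vertex is charged to `b`,
  -- every other one to its own lowest vertex. The Boolean separates the two kinds.
  let f : β × β → β × Bool := fun e =>
    if m e.1 e.2 = n e.2 then (e.2, true) else (m e.1 e.2, false)
  -- the charged vertex determines the upper end and the class of the lower end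
  have hlt : ∀ {a b a' b'}, (a, b) ∈ up → (a', b') ∈ up → m a b ≠ n b → m a b = m a' b' →
      ¬ ρ b < ρ b' := by
    intro a b a' b' h h' hne he hlt
    obtain ⟨⟨a₁, ha₁, hr₁⟩, hnmin⟩ := hn b a h
    have hab := (hmem.1 h)
    have hab₁ := (hmem.1 ha₁)
    -- Below the higher vertex `b'`, the vertex `b` is available and joins its lower classes, so `n
    -- b` competes with the minimum `m a' b'`.
    have hr : R b' (m a b) (n b) := by
      have h1 : R b' (m a b) a := Rmono hlt.le (Rsymm (hm a b))
      have h2 : R b' a₁ (n b) := Rmono hlt.le hr₁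
      exact ((h1.tail ⟨hab.1, hab.2.trans hlt, hlt⟩).tail
        ⟨hsymm hab₁.1, hlt, hab₁.2.trans hlt⟩).trans h2
    have h3 := hnmin a _ h (hm a b)
    have h4 : ρ (m a b) ≤ ρ (n b) := by
      have := hmin a' b' (n b) ((hm a' b').trans (he ▸ hr))
      rwa [← he] at this
    exact hne (hρ (Rreach hr) (le_antisymm h4 h3))
  have hfib : ∀ {a b a' b'}, (a, b) ∈ up → (a', b') ∈ up → f (a, b) = f (a', b') →
      b = b' ∧ R b a a' := by
    intro a b a' b' h h' hf
    have hb : b = b' ∧ m a b = m a' b' := by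
      simp only [f] at hf
      split_ifs at hf with h1 h2 h2
      · simp only [Prod.mk.injEq, and_true] at hf
        subst hf
        exact ⟨rfl, h1.trans h2.symm⟩
      · simp at hf
      · simp at hf
      · simp only [Prod.mk.injEq, and_true] at hf
        refine ⟨hρ ?_ (le_antisymm (not_lt.1 (hlt h' h h2 hf.symm)) (not_lt.1 (hlt h h' h1 hf))), hf⟩
        exact (Relation.ReflTransGen.head (hsymm (hmem.1 h).1) (Rreach (hm a b))).trans
          (hf ▸ (Rreach (Rsymm (hm a' b'))).tail (hmem.1 h').1)
    obtain ⟨rfl, he⟩ := hb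
    exact ⟨rfl, (hm a b).trans (he ▸ Rsymm (hm a' b))⟩
  -- Edges with the same charge share their upper end and the class below it. Among four of them,
  -- the one with the highest lower end would be good.
  have h3 : bad.card ≤ 3 * (bad.image f).card := by
    refine Finset.card_le_mul_card_image bad 3 fun c _ => ?_
    by_contra! hc
    set X := bad.filter fun e => f e = c with hX
    have hXmem : ∀ {e}, e ∈ X → (e.1, e.2) ∈ up ∧ ¬ IsGoodEdge E ρ e.1 e.2 ∧ f (e.1, e.2) = c := by
      intro e he
      simp only [hX, hbad, Finset.mem_filter] at he
      exact ⟨he.1.1, he.1.2, he.2⟩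
    obtain ⟨⟨a, b⟩, hab, hmax⟩ := X.exists_max_image (fun e => ρ e.1)
      (Finset.card_pos.1 (by omega))
    obtain ⟨h1, h2, h3⟩ := hXmem hab
    refine h2 ⟨(hmem.1 h1).2, (X.erase (a, b)).image Prod.fst, ?_, ?_⟩
    · rw [Finset.card_image_of_injOn, Finset.card_erase_of_mem hab]
      · omega
      · rintro ⟨a₁, b₁⟩ he₁ ⟨a₂, b₂⟩ he₂ he
        simp only [Finset.coe_erase, Set.mem_sdiff, Finset.mem_coe] at he₁ he₂ he
        obtain ⟨h4, -, h5⟩ := hXmem he₁.1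
        obtain ⟨h6, -, h7⟩ := hXmem he₂.1
        obtain rfl : b₁ = b₂ := (hfib h4 h6 (h5.trans (he ▸ h7.symm))).1
        rw [he]
    · intro d hd
      obtain ⟨⟨d, b₁⟩, he, rfl⟩ := Finset.mem_image.1 hd
      obtain ⟨hne, he⟩ := Finset.mem_erase.1 he
      obtain ⟨h4, -, h5⟩ := hXmem he
      obtain ⟨hb, hr⟩ := hfib h1 h4 (h3.trans h5.symm)
      simp only at hb hr h4 ⊢
      subst hb
      refine ⟨hsymm (hmem.1 h4).1, lt_of_le_of_ne (hmax _ he) fun h => hne ?_, hr⟩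
      rw [hρ (Rreach hr) h.symm]
  have h4 : (bad.image f).card ≤ 2 * S.card := by
    have : bad.image f ⊆ S ×ˢ Finset.univ := by
      intro c hc
      obtain ⟨⟨a, b⟩, he, rfl⟩ := Finset.mem_image.1 hc
      have h1 := (hmem.1 (Finset.mem_filter.1 he).1).1
      simp only [f]
      split_ifs
      · simpa [hS] using ⟨a, hsymm h1⟩
      · simp only [hS, Finset.mem_product, Finset.mem_image, Finset.mem_univ, and_true,
          Prod.exists, exists_and_right, exists_eq_right]
        by_cases hne : a = m a b
        · exact ⟨b, hne ▸ h1⟩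
        · obtain ⟨-, d, hd⟩ := exists_rel_of_reflTransGen (hm a b) hne
          exact ⟨d, hsymm hd.1⟩
    have := Finset.card_le_card this
    rw [Finset.card_product, Finset.card_univ, Fintype.card_bool] at this
    omega
  have h5 : up.card ≤ (E.filter fun e => IsGoodEdge E ρ e.1 e.2).card + bad.card := by
    rw [← Finset.card_filter_add_card_filter_not (s := up) (fun e => IsGoodEdge E ρ e.1 e.2)]
    refine Nat.add_le_add_right (Finset.card_le_card ?_) _
    exact Finset.filter_subset_filter _ (Finset.filter_subset _ _)
  omega

/-! ### Comparing the links of all points. -/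

/-- The smallest element of a set, as a natural number. -/
noncomputable def minVal {n : ℕ} (A : Finset (Fin n)) : ℕ :=
  sInf (Fin.val '' (A : Set (Fin n)))

theorem exists_mem_minVal {n : ℕ} {A : Finset (Fin n)} (h : A.Nonempty) :
    ∃ y ∈ A, y.val = minVal A := by
  obtain ⟨y, hy, h⟩ := Nat.sInf_mem (s := Fin.val '' (A : Set (Fin n))) (Set.Nonempty.image _ h)
  exact ⟨y, hy, h⟩

theorem minVal_le {n : ℕ} {A : Finset (Fin n)} {y : Fin n} (h : y ∈ A) : minVal A ≤ y.val :=
  Nat.sInf_le ⟨y, h, rfl⟩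

/-- The pair `(y, z)` consists of the least elements of the ends of a good edge. -/
def IsGoodPair {n : ℕ} (E : Finset (Finset (Fin n) × Finset (Fin n))) (y z : Fin n) : Prop :=
  ∃ A B, (A, B) ∈ E ∧ IsGoodEdge E minVal A B ∧ y ∈ A ∧ z ∈ B ∧ y.val = minVal A ∧
    z.val = minVal B

/-- Corresponding ends have equal minima. The neighbours provided by goodness have smaller minima,
so neither edge's union covers the neighbours of the other, which is what `false_of_shared` needs.
-/
theorem EdgeSystem.not_isGoodPair {n : ℕ} {G : Finset (Finset (Fin n))} {x x' : Fin n}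
    {E E' : Finset (Finset (Fin n) × Finset (Fin n))} (hE : EdgeSystem G x E)
    (hE' : EdgeSystem G x' E') (hG : RegionFree 6 G) (hxx : x ≠ x') {y z : Fin n}
    (h : IsGoodPair E y z) (h' : IsGoodPair E' y z) : False := by
  obtain ⟨A, B, hAB, ⟨hlt, N, hN, hNE⟩, hy, hz, hyA, hzB⟩ := h
  obtain ⟨A', B', hAB', ⟨hlt', N', hN', hNE'⟩, hy', hz', hyA', hzB'⟩ := h'
  have key : ∀ {E : Finset (Finset (Fin n) × Finset (Fin n))} {x : Fin n}, EdgeSystem G x E →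
      ∀ {A B C D K : Finset (Fin n)}, (B, D) ∈ E → minVal A = minVal C → minVal B = minVal K →
      minVal A < minVal B → minVal D < minVal A → ¬ D ⊆ C ∪ K := by
    intro E x hE A B C D K hBD h1 h2 h3 h4 hsub
    obtain ⟨t, ht, htD⟩ := exists_mem_minVal (hE.nonempty (hE.symm hBD))
    rcases Finset.mem_union.1 (hsub ht) with h | h
    · have := minVal_le h
      omega
    · have := minVal_le h
      omega
  refine hE.false_of_shared hE' hG hxx hAB hAB' hy hy' hz hz' N hN ?_ N' hN' ?_
  · intro D hD
    obtain ⟨h1, h2, h3⟩ := hNE D hD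
    refine ⟨h1, key hE h1 (hyA.symm.trans hyA') (hzB.symm.trans hzB') hlt h2, ?_⟩
    exact Relation.ReflTransGen.mono (fun C D h => ⟨h.1, fun e => by simp [e] at h,
      fun e => by simp [e] at h⟩) _ _ h3
  · intro D hD
    obtain ⟨h1, h2, h3⟩ := hNE' D hD
    refine ⟨h1, key hE' h1 (hyA'.symm.trans hyA) (hzB'.symm.trans hzB) hlt' h2, ?_⟩
    exact Relation.ReflTransGen.mono (fun C D h => ⟨h.1, fun e => by simp [e] at h,
      fun e => by simp [e] at h⟩) _ _ h3

/-- The link of a point is linear in size, up to a contribution of pairs of points that cannot be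
shared with other links. -/
theorem RegionFree.exists_card_linkFamily_le {n : ℕ} {G : Finset (Finset (Fin n))}
    (hG : RegionFree 6 G) {V : Finset (Fin n)} (hV : ∀ T ∈ G, T ⊆ V) (x : Fin n) :
    ∃ E, EdgeSystem G x E ∧ ∃ P ⊆ V ×ˢ V, (∀ p ∈ P, IsGoodPair E p.1 p.2) ∧
      (linkFamily G x).card ≤ 25 * (4 * V.card + 1) + 2 * P.card := by
  classical
  have hH : RegionFree 5 (linkFamily G x) := RegionFree.link (by norm_num) hG x
  have hVH : ∀ T ∈ linkFamily G x, T ⊆ V := fun T hT => hV T (mem_linkFamily.1 hT).1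
  obtain ⟨E₀, hE₀, hm₀, hc₀, hS₀⟩ := hH.exists_splitGraph hVH
  obtain ⟨E, hsub, hsymm, hdeg, hc⟩ := exists_subgraph_degree_ge 6 (E₀.image Prod.fst) E₀
    (fun e he => Finset.mem_image_of_mem _ he) hE₀.symm
  have hsg : SplitGraph E := hE₀.mono hsub hsymm
  have hd : SplitGraph.HasDegrees E := fun h => le_trans (by norm_num) (hdeg h)
  have hE : EdgeSystem G x E := hsg.edgeSystem hdeg fun e he => hm₀ e (hsub he)
  have hgood := card_le_card_goodEdges E minVal hsymm hE.ne (by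
    intro A B hr hAB
    by_contra hne
    obtain ⟨⟨C, hC⟩, D, hD⟩ := exists_rel_of_reflTransGen hr hne
    obtain ⟨a, ha, ha'⟩ := exists_mem_minVal (hE.nonempty hC)
    obtain ⟨b, hb, hb'⟩ := exists_mem_minVal (hE.nonempty (hE.symm hD))
    have hab : a = b := Fin.ext (by omega)
    exact Finset.disjoint_left.1 (hE.disjoint_of_reach hr hne) ha (hab ▸ hb))
  set good := E.filter fun e => IsGoodEdge E minVal e.1 e.2 with hg
  have hch : ∀ e ∈ good, ∃ p : Fin n × Fin n, p.1 ∈ e.1 ∧ p.2 ∈ e.2 ∧ p.1.val = minVal e.1 ∧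
      p.2.val = minVal e.2 := by
    rintro ⟨A, B⟩ he
    have hAB := (Finset.mem_filter.1 he).1
    obtain ⟨a, ha, ha'⟩ := exists_mem_minVal (hE.nonempty hAB)
    obtain ⟨b, hb, hb'⟩ := exists_mem_minVal (hE.nonempty (hE.symm hAB))
    exact ⟨(a, b), ha, hb, ha', hb'⟩
  have : Nonempty (Fin n × Fin n) := ⟨(x, x)⟩
  choose! p hp using hch
  refine ⟨E, hE, good.image p, ?_, ?_, ?_⟩
  · intro q hq
    obtain ⟨⟨A, B⟩, he, rfl⟩ := Finset.mem_image.1 hq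
    have hAB := Finset.union_subset_iff.1 (hVH _ (hE.mem (Finset.mem_filter.1 he).1))
    exact Finset.mem_product.2 ⟨hAB.1 (hp _ he).1, hAB.2 (hp _ he).2.1⟩
  · intro q hq
    obtain ⟨⟨A, B⟩, he, rfl⟩ := Finset.mem_image.1 hq
    exact ⟨A, B, (Finset.mem_filter.1 he).1, (Finset.mem_filter.1 he).2, hp _ he⟩
  · have hinj : Set.InjOn p good := by
      rintro ⟨A, B⟩ he ⟨A', B'⟩ he' hpp
      have h := hp _ he
      have h' := hp _ he'
      rw [← hpp] at h'
      obtain ⟨h1, h2⟩ := hsg.eq_of_mem hd (Finset.mem_filter.1 he).1 (Finset.mem_filter.1 he').1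
        h.1 h'.1 h.2.1 h'.2.1
      rw [h1, h2]
    -- The 25 below is 1 + 12 + 12, in units of `4 * V.card + 1`: members without a canonical
    -- partition, pruned edges, and the loss to edges that are not good.
    rw [Finset.card_image_of_injOn hinj]
    have h1 : (E.image Prod.fst).card ≤ (E₀.image Prod.fst).card :=
      Finset.card_le_card (Finset.image_subset_image hsub)
    omega

/-- The pair sets of different points are disjoint subsets of `V ×ˢ V`, so on average they have at
most `V.card` elements. The bound is then `102 * V.card + 25`. -/
theorem RegionFree.exists_linkFamily_card_le {n : ℕ} {G : Finset (Finset (Fin n))}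
    (hG : RegionFree 6 G) {V : Finset (Fin n)} (hV : ∀ T ∈ G, T ⊆ V) (hne : V.Nonempty) :
    ∃ x ∈ V, (linkFamily G x).card ≤ 127 * V.card := by
  have hm : 1 ≤ V.card := Finset.card_pos.2 hne
  choose E hE P hPV hP hcard using fun x => hG.exists_card_linkFamily_le hV x
  by_contra! hcon
  have hdisj : (V : Set (Fin n)).PairwiseDisjoint P := by
    intro x _ x' _ hxx
    rw [Function.onFun, Finset.disjoint_left]
    exact fun p hp hp' => (hE x).not_isGoodPair (hE x') hG hxx (hP x p hp) (hP x' p hp')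
  have h1 : ∑ x ∈ V, (P x).card ≤ V.card * V.card := by
    rw [← Finset.card_biUnion hdisj, ← Finset.card_product]
    exact Finset.card_le_card (Finset.biUnion_subset.2 fun x _ => hPV x)
  have h2 : ∑ x ∈ V, (127 * V.card + 1) ≤ ∑ x ∈ V, (25 * (4 * V.card + 1) + 2 * (P x).card) :=
    Finset.sum_le_sum fun x hx => le_trans (hcon x hx) (hcard x)
  rw [Finset.sum_const, smul_eq_mul, Finset.sum_add_distrib, Finset.sum_const, smul_eq_mul,
    ← Finset.mul_sum] at h2
  nlinarith

/-! ### Quadratic and cubic bounds by induction on the ground set. -/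

theorem RegionFree.card_le_of_six {n : ℕ} (m : ℕ) :
    ∀ (G : Finset (Finset (Fin n))) (V : Finset (Fin n)), RegionFree 6 G → (∀ T ∈ G, T ⊆ V) →
      V.card = m → G.card ≤ 127 * m ^ 2 + 1 := by
  induction m with
  | zero =>
    intro G V _ hV hm
    have : G ⊆ {∅} := fun T hT => by
      have := hV T hT
      rw [Finset.card_eq_zero.1 hm, Finset.subset_empty] at this
      simp [this]
    simpa using Finset.card_le_card this
  | succ m ih =>
    intro G V hG hV hm
    obtain ⟨x, hx, hlink⟩ := hG.exists_linkFamily_card_le hV (Finset.card_pos.1 (by omega))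
    have h1 := ih (G.image fun A => A.erase x) (V.erase x) (hG.image_erase x) (by
      intro T hT
      obtain ⟨S, hS, rfl⟩ := Finset.mem_image.1 hT
      exact Finset.erase_subset_erase x (hV S hS)) (by
      rw [Finset.card_erase_of_mem hx, hm]; rfl)
    rw [card_eq_image_erase_add_linkFamily G x]
    rw [hm] at hlink
    nlinarith

theorem RegionFree.card_le_of_seven {n : ℕ} (m : ℕ) :
    ∀ (G : Finset (Finset (Fin n))) (V : Finset (Fin n)), RegionFree 7 G → (∀ T ∈ G, T ⊆ V) →
      V.card = m → G.card ≤ 128 * m ^ 3 + 1 := by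
  induction m with
  | zero =>
    intro G V _ hV hm
    have : G ⊆ {∅} := fun T hT => by
      have := hV T hT
      rw [Finset.card_eq_zero.1 hm, Finset.subset_empty] at this
      simp [this]
    simpa using Finset.card_le_card this
  | succ m ih =>
    intro G V hG hV hm
    obtain ⟨x, hx⟩ := Finset.card_pos.1 (show 0 < V.card by omega)
    have h1 := ih (G.image fun A => A.erase x) (V.erase x) (hG.image_erase x) (by
      intro T hT
      obtain ⟨S, hS, rfl⟩ := Finset.mem_image.1 hT
      exact Finset.erase_subset_erase x (hV S hS)) (by
      rw [Finset.card_erase_of_mem hx, hm]; rfl)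
    have h2 := RegionFree.card_le_of_six (m + 1) (linkFamily G x) V
      (RegionFree.link (by norm_num) hG x) (fun T hT => hV T (mem_linkFamily.1 hT).1) hm
    rw [card_eq_image_erase_add_linkFamily G x]
    nlinarith

/-! ### From regions to the dual VC-dimension, and sharpness. -/

theorem isThreeVenn_iff {n : ℕ} {X Y Z : Finset (Fin n)} :
    IsThreeVenn X Y Z ↔ ∀ a b c : Bool, ∃ p, (p ∈ X ↔ a = true) ∧ (p ∈ Y ↔ b = true) ∧
      (p ∈ Z ↔ c = true) := by
  simp only [Bool.forall_bool, IsThreeVenn, Finset.Nonempty, Finset.mem_inter, Finset.mem_compl,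
    and_assoc, Bool.false_eq_true, iff_false, iff_true]
  constructor
  · rintro ⟨h1, h2, h3, h4, h5, h6, h7, h8⟩
    exact ⟨h8, h5, h6, h2, h7, h3, h4, h1⟩
  · rintro ⟨h8, h5, h6, h2, h7, h3, h4, h1⟩
    exact ⟨h1, h2, h3, h4, h5, h6, h7, h8⟩

/-- A family without three sets in general position has at most cubic size. -/
theorem card_le_of_forall_not_isThreeVenn {n : ℕ} (hn : 1 ≤ n) {F : Finset (Finset (Fin n))}
    (hF : ∀ X ∈ F, ∀ Y ∈ F, ∀ Z ∈ F, ¬ IsThreeVenn X Y Z) : F.card ≤ 258 * n ^ 3 := by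
  let r : Fin n := ⟨0, hn⟩
  let f : Finset (Fin n) → Finset (Fin n) := fun A => if r ∈ A then Aᶜ else A
  have hr : ∀ A, r ∉ f A := by
    intro A
    by_cases h : r ∈ A <;> simp [f, h]
  have hfmem : ∀ A, ∃ e : Bool, ∀ p, p ∈ f A ↔ (p ∈ A ↔ e = true) := by
    intro A
    by_cases h : r ∈ A
    · exact ⟨false, fun p => by simp [f, h]⟩
    · exact ⟨true, fun p => by simp [f, h]⟩
  have h1 : F.card ≤ 2 * (F.image f).card := by
    refine Finset.card_le_mul_card_image F 2 fun B _ => ?_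
    refine (Finset.card_le_card (t := {B, Bᶜ}) ?_).trans Finset.card_le_two
    intro A hA
    rw [Finset.mem_filter] at hA
    rw [Finset.mem_insert, Finset.mem_singleton, ← hA.2]
    by_cases h : r ∈ A <;> simp [f, h]
  have h2 : RegionFree 7 (F.image f) := by
    intro X hX Y hY Z hZ
    simp only [Finset.mem_image] at hX hY hZ
    obtain ⟨X, hX, rfl⟩ := hX
    obtain ⟨Y, hY, rfl⟩ := hY
    obtain ⟨Z, hZ, rfl⟩ := hZ
    by_contra! h7
    refine hF X hX Y hY Z hZ (isThreeVenn_iff.2 fun a b c => ?_)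
    have hall : innerRegions (f X) (f Y) (f Z) = Finset.univ.erase (false, false, false) := by
      refine Finset.eq_of_subset_of_card_le ?_ (le_trans (by decide) h7)
      intro c hc
      exact Finset.mem_erase.2 ⟨(mem_innerRegions.1 hc).1, Finset.mem_univ _⟩
    have hcode : ∀ c, ∃ p, vennCode (f X) (f Y) (f Z) p = c := by
      intro c
      by_cases hc : c = (false, false, false)
      · exact ⟨r, by simp [vennCode, hc, hr]⟩
      · exact (mem_innerRegions.1 (hall ▸ Finset.mem_erase.2 ⟨hc, Finset.mem_univ _⟩)).2
    obtain ⟨e₁, h₁⟩ := hfmem X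
    obtain ⟨e₂, h₂⟩ := hfmem Y
    obtain ⟨e₃, h₃⟩ := hfmem Z
    obtain ⟨p, hp⟩ := hcode (a == e₁, b == e₂, c == e₃)
    simp only [vennCode, Prod.mk.injEq] at hp
    obtain ⟨hp₁, hp₂, hp₃⟩ := hp
    have aux : ∀ {Q R : Prop} [Decidable R] {a e : Bool}, (R ↔ (Q ↔ e = true)) →
        decide R = (a == e) → (Q ↔ a = true) := by
      intro Q R _ a e h h'
      by_cases hR : R <;> cases a <;> cases e <;> simp_all
    exact ⟨p, aux (h₁ p) hp₁, aux (h₂ p) hp₂, aux (h₃ p) hp₃⟩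
  -- The constant is 258 = 2 · (128 + 1), absorbing the additive 1 into `n ^ 3`.
  have h3 := RegionFree.card_le_of_seven n (F.image f) Finset.univ h2
    (fun T _ => Finset.subset_univ T) (by simp)
  have h4 : 1 ≤ n ^ 3 := Nat.one_le_pow _ _ hn
  omega

theorem three_le_dualVCDim_iff {n : ℕ} (F : Finset (Finset (Fin n))) :
    3 ≤ dualVCDim F ↔ ∃ X ∈ F, ∃ Y ∈ F, ∃ Z ∈ F, IsThreeVenn X Y Z := by
  constructor
  · intro h
    obtain ⟨s, hs, h3⟩ := (Finset.le_sup_iff (by norm_num)).1 h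
    obtain ⟨t, hts, ht⟩ := Finset.exists_subset_card_eq h3
    have hsh := (Finset.mem_shatterer.1 hs).mono_right hts
    obtain ⟨X, Y, Z, hXY, hXZ, hYZ, rfl⟩ := Finset.card_eq_three.1 ht
    obtain ⟨u, hu, hsub⟩ := hsh.exists_superset
    obtain ⟨q, -, rfl⟩ := Finset.mem_image.1 hu
    have hF : ∀ W ∈ ({X, Y, Z} : Finset (Finset (Fin n))), W ∈ F := fun W hW =>
      (Finset.mem_filter.1 (hsub hW)).1
    have hX := hF X (by simp)
    have hY := hF Y (by simp)
    have hZ := hF Z (by simp)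
    refine ⟨X, hX, Y, hY, Z, hZ, isThreeVenn_iff.2 fun a b c => ?_⟩
    obtain ⟨u, hu, he⟩ := hsh (t := ({X, Y, Z} : Finset (Finset (Fin n))).filter fun W =>
      (W = X ∧ a = true) ∨ (W = Y ∧ b = true) ∨ (W = Z ∧ c = true)) (Finset.filter_subset _ _)
    obtain ⟨p, -, rfl⟩ := Finset.mem_image.1 hu
    have h1 := Finset.ext_iff.1 he X
    have h2 := Finset.ext_iff.1 he Y
    have h3 := Finset.ext_iff.1 he Z
    simp only [Finset.mem_inter, Finset.mem_insert, Finset.mem_singleton, Finset.mem_filter, hX, hY,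
      hZ, hXY, hXZ, hYZ, hXY.symm, hXZ.symm, hYZ.symm, true_and, or_true, false_and,
      or_false, false_or] at h1 h2 h3
    exact ⟨p, h1, h2, h3⟩
  · rintro ⟨X, hX, Y, hY, Z, hZ, h⟩
    rw [isThreeVenn_iff] at h
    have hXY : X ≠ Y := by
      rintro rfl
      obtain ⟨p, h1, h2, -⟩ := h true false true
      simp [h1] at h2
    have hXZ : X ≠ Z := by
      rintro rfl
      obtain ⟨p, h1, -, h2⟩ := h true true false
      simp [h1] at h2
    have hYZ : Y ≠ Z := by
      rintro rfl
      obtain ⟨p, -, h1, h2⟩ := h true true false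
      simp [h1] at h2
    have hsh : (dualFamily F).Shatters {X, Y, Z} := by
      intro t ht
      obtain ⟨p, h1, h2, h3⟩ := h (decide (X ∈ t)) (decide (Y ∈ t)) (decide (Z ∈ t))
      rw [decide_eq_true_iff] at h1 h2 h3
      refine ⟨_, Finset.mem_image_of_mem _ (Finset.mem_univ p), ?_⟩
      ext W
      simp only [Finset.mem_inter, Finset.mem_insert, Finset.mem_singleton, Finset.mem_filter]
      constructor
      · rintro ⟨rfl | rfl | rfl, -, hp⟩
        exacts [h1.1 hp, h2.1 hp, h3.1 hp]
      · intro hW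
        have hW' := ht hW
        simp only [Finset.mem_insert, Finset.mem_singleton] at hW'
        refine ⟨hW', ?_⟩
        rcases hW' with rfl | rfl | rfl
        exacts [⟨hX, h1.2 hW⟩, ⟨hY, h2.2 hW⟩, ⟨hZ, h3.2 hW⟩]
    have := hsh.card_le_vcDim
    rwa [Finset.card_eq_three.2 ⟨X, Y, Z, hXY, hXZ, hYZ, rfl⟩] at this

/-- Four of the eight regions lie in `X`. -/
theorem IsThreeVenn.four_le_card {n : ℕ} {X Y Z : Finset (Fin n)} (h : IsThreeVenn X Y Z) :
    4 ≤ X.card := by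
  rw [isThreeVenn_iff] at h
  choose p hX hY hZ using fun e : Bool × Bool => h true e.1 e.2
  have := Finset.card_le_card_of_injOn (s := Finset.univ) (t := X) p
    (fun e _ => (hX e).2 rfl) (by
      intro e _ e' _ he
      have h1 := hY e
      have h2 := hZ e
      rw [he, hY e', ← Bool.eq_iff_iff] at h1
      rw [he, hZ e', ← Bool.eq_iff_iff] at h2
      exact (Prod.ext h1 h2).symm)
  simpa using this

theorem dualVCDim_setsOfSizeAtMostThree_le (n : ℕ) :
    dualVCDim (setsOfSizeAtMostThree n) ≤ 2 := by
  by_contra! h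
  obtain ⟨X, hX, Y, -, Z, -, hv⟩ := (three_le_dualVCDim_iff _).1 h
  have h3 : X.card ≤ 3 := (Finset.mem_filter.1 hX).2
  have := hv.four_le_card
  omega

theorem pow_three_le_card_setsOfSizeAtMostThree (n : ℕ) :
    n ^ 3 ≤ 27 * (setsOfSizeAtMostThree n).card := by
  let f : Fin n × Fin n × Fin n → Finset (Fin n) := fun a => {a.1, a.2.1, a.2.2}
  have h1 := Finset.card_le_mul_card_image_of_maps_to (s := Finset.univ)
    (t := setsOfSizeAtMostThree n) (f := f)
    (fun a _ => Finset.mem_filter.2 ⟨Finset.mem_univ _, Finset.card_le_three⟩) 27 (by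
      intro S hS
      have hS : S.card ≤ 3 := (Finset.mem_filter.1 hS).2
      refine (Finset.card_le_card (t := S ×ˢ S ×ˢ S) ?_).trans ?_
      · intro a ha
        obtain ⟨-, rfl⟩ := Finset.mem_filter.1 ha
        simp [f]
      · rw [Finset.card_product, Finset.card_product]
        calc S.card * (S.card * S.card) ≤ 3 * (3 * 3) := by gcongr
          _ = 27 := by norm_num)
  simp only [Finset.card_univ, Fintype.card_prod, Fintype.card_fin] at h1
  calc n ^ 3 = n * (n * n) := by ring
    _ ≤ _ := h1

theorem theorem1 :
    -- the upper bound, in both forms, with one absolute constant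
    (∃ C : ℝ, 0 < C ∧
      (∀ n : ℕ, 1 ≤ n → ∀ F : Finset (Finset (Fin n)),
        dualVCDim F ≤ 2 → (F.card : ℝ) ≤ C * (n : ℝ) ^ 3) ∧
      (∀ n : ℕ, 1 ≤ n → ∀ F : Finset (Finset (Fin n)),
        C * (n : ℝ) ^ 3 ≤ (F.card : ℝ) →
          ∃ X ∈ F, ∃ Y ∈ F, ∃ Z ∈ F, IsThreeVenn X Y Z)) ∧
    -- the two forms speak of the same families
    (∀ (n : ℕ) (F : Finset (Finset (Fin n))),
      3 ≤ dualVCDim F ↔ ∃ X ∈ F, ∃ Y ∈ F, ∃ Z ∈ F, IsThreeVenn X Y Z) ∧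
    -- sharpness up to the constant
    (∀ n : ℕ, dualVCDim (setsOfSizeAtMostThree n) ≤ 2) ∧
    (∃ c : ℝ, 0 < c ∧ ∀ n : ℕ,
      c * (n : ℝ) ^ 3 ≤ ((setsOfSizeAtMostThree n).card : ℝ)) := by
  -- Raising 258 to 259 makes the inequality strict, as the second form needs in the case of
  -- equality.
  have hbound : ∀ n : ℕ, 1 ≤ n → ∀ F : Finset (Finset (Fin n)),
      (¬ ∃ X ∈ F, ∃ Y ∈ F, ∃ Z ∈ F, IsThreeVenn X Y Z) → (F.card : ℝ) < 259 * (n : ℝ) ^ 3 := by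
    intro n hn F hF
    have h : F.card ≤ 258 * n ^ 3 := card_le_of_forall_not_isThreeVenn hn
      fun X hX Y hY Z hZ hv => hF ⟨X, hX, Y, hY, Z, hZ, hv⟩
    have h1 : (F.card : ℝ) ≤ 258 * (n : ℝ) ^ 3 := by exact_mod_cast h
    have h2 : (0 : ℝ) < (n : ℝ) ^ 3 := by positivity
    linarith
  refine ⟨⟨259, by norm_num, fun n hn F hF => (hbound n hn F ?_).le, fun n hn F hF => ?_⟩,
    fun n F => three_le_dualVCDim_iff F, dualVCDim_setsOfSizeAtMostThree_le,
    ⟨1 / 27, by norm_num, fun n => ?_⟩⟩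
  · rw [← three_le_dualVCDim_iff]
    omega
  · by_contra h
    exact absurd hF (not_le.2 (hbound n hn F h))
  · have h : (n : ℝ) ^ 3 ≤ 27 * ((setsOfSizeAtMostThree n).card : ℝ) := by
      exact_mod_cast pow_three_le_card_setsOfSizeAtMostThree n
    linarith
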